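/- **Setting.** Let $(\mathsf X,\mathcal X)$ be a measurable space with a $\sigma$-finite measure $\lambda$ (write $\mathrm dx=\lambda(\mathrm dx)$), $\chi$ a probability measure on $\mathsf X$, $q$ a measurable Markov transition density w.r.t. $\lambda$, $Q(x,\mathrm dx')=q(x,x')\,\mathrm dx'$, and $(g_t)_{t\ge0}$ positive measurable functions on $\mathsf X$. For $0\le s\le T$ and bounded measurable $h$, the marginal smoothing distribution is $$\phi_{\chi,s|T}[h]=\frac{\int\chi(\mathrm dx_0)g_0(x_0)\prod_{u=1}^TQ(x_{u-1},\mathrm dx_u)g_u(x_u)\,h(x_s)}{\int\chi(\mathrm dx_0)g_0(x_0)\prod_{u=1}^TQ(x_{u-1},\mathrm dx_u)g_u(x_u)}.$$ For an expression $a/b$ with nonnegative $a,b$, "bounded" means $a\le Kb$ everywhere for some finite constant $K$. *Forward filter.* Let $\rho_0$ be a probability measure with $\chi\ll\rho_0$, $\vartheta_t\ge0$ measurable functions and $p_t$ Markov transition densities w.r.t. $\lambda$ ($t\ge1$). Put $\omega_0(x)=\frac{\mathrm d\chi}{\mathrm d\rho_0}(x)g_0(x)$ and $\omega_t(x,x')=\frac{q(x,x')g_t(x')}{\vartheta_t(x)p_t(x,x')}$.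 Draw $\xi_0^1,\dots,\xi_0^N$ i.i.d. from $\rho_0$ with weights $\omega_0^i=\omega_0(\xi_0^i)$; at time $t\ge1$, given the past, draw $N$ independent pairs $(I_t^\ell,\xi_t^\ell)$ from the density on $\{1,\dots,N\}\times\mathsf X$ proportional to $(i,x)\mapsto\omega_{t-1}^i\vartheta_t(\xi_{t-1}^i)p_t(\xi_{t-1}^i,x)$, with weights $\omega_t^\ell=\omega_t(\xi_{t-1}^{I_t^\ell},\xi_t^\ell)$. *Backward information filter.* Let $(\gamma_t)$ be positive measurable functions with $\int\gamma_t(x_t)\,\mathrm dx_t\big[\prod_{u=t+1}^Tg_{u-1}(x_{u-1})Q(x_{u-1},\mathrm dx_u)\big]g_T(x_T)<\infty$ for $0\le t\le T$, $\check\rho_T$ a probability density, $\check\vartheta_t\ge0$ measurable functions and $\check p_t$ Markov transition densities w.r.t. $\lambda$. Put $\check\omega_T(x)=\frac{g_T(x)\gamma_T(x)}{\check\rho_T(x)}$ and, for $t<T$, $\check\omega_t(x,x')=\frac{\gamma_t(x)g_t(x)q(x,x')}{\check\vartheta_t(x')\check p_t(x',x)}$. Independently of the forward filter, draw $\check\xi_T^1,\dots,\check\xi_T^N$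 i.i.d. from $\check\rho_T$ with weights $\check\omega_T^i=\check\omega_T(\check\xi_T^i)$; at time $t<T$, given the particles at times $>t$, draw $N$ independent pairs $(\check I_t^\ell,\check\xi_t^\ell)$ from the density proportional to $(i,x)\mapsto\check\omega_{t+1}^i\check\vartheta_t(\check\xi_{t+1}^i)\check p_t(\check\xi_{t+1}^i,x)/\gamma_{t+1}(\check\xi_{t+1}^i)$, with weights $\check\omega_t^\ell=\check\omega_t(\check\xi_t^\ell,\check\xi_{t+1}^{\check I_t^\ell})$. *Reweighted particles.* For $1\le s\le T-1$ put $$\tilde\omega_{s}^{i,\mathrm f}=\omega_s^i\sum_{j=1}^N\check\omega_{s+1}^j\frac{q(\xi_s^i,\check\xi_{s+1}^j)}{\gamma_{s+1}(\check\xi_{s+1}^j)},\qquad\tilde\omega_{s}^{j,\mathrm b}=\check\omega_s^j\sum_{i=1}^N\omega_{s-1}^i\frac{q(\xi_{s-1}^i,\check\xi_s^j)}{\gamma_s(\check\xi_s^j)},$$ and $\tilde\Omega^{\mathrm f}_s=\sum_i\tilde\omega_s^{i,\mathrm f}$, $\tilde\Omega^{\mathrm b}_s=\sum_j\tilde\omega_s^{j,\mathrm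 b}$. Whenever all the $N$ weights to be normalized (in a resampling step or in an estimator) vanish, the normalized weights are taken to be $1/N$. **Assumptions.** - A1: $q$ and $g_t$, $0\le t\le T$, are bounded. - A2: $\omega_0$ is bounded ($\rho_0$-a.e.), and $\vartheta_t$, $p_t$ and $\omega_t$ are bounded for $1\le t\le T$. - A3: $\check\vartheta_t/\gamma_{t+1}$ and $\check p_t$ are bounded for $0\le t\le T-1$, $\check\omega_t$ is bounded for $0\le t\le T$, and $(x,x')\mapsto q(x,x')/\gamma_{t+1}(x')$ is bounded for $1\le t\le T-1$. **Theorem.** Assume A1–A3 and let $1\le s\le T-1$. There are constants $0<B,C<\infty$ such that for all $N\ge1$, $\varepsilon>0$ and all bounded measurable $h:\mathsf X\to\mathbb R$, with $\mathrm{osc}(h)=\sup_{z,z'}|h(z)-h(z')|$, $$\mathbb P\Big(\Big|\sum_{i=1}^N\frac{\tilde\omega_s^{i,\mathrm f}}{\tilde\Omega_s^{\mathrm f}}h(\xi_s^i)-\phi_{\chi,s|T}[h]\Big|>\varepsilon\Big)\le B\,e^{-CN\varepsilon^2/\mathrm{osc}^2(h)},$$ and, provided in the case $s=1$ that also $(x,x')\mapsto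 q(x,x')/\gamma_1(x')$ is bounded, $$\mathbb P\Big(\Big|\sum_{i=1}^N\frac{\tilde\omega_s^{i,\mathrm b}}{\tilde\Omega_s^{\mathrm b}}h(\check\xi_s^i)-\phi_{\chi,s|T}[h]\Big|>\varepsilon\Big)\le B\,e^{-CN\varepsilon^2/\mathrm{osc}^2(h)}.$$ If $\mathrm{osc}(h)=0$, the right-hand sides are read as $0$. -/

import Mathlib

open MeasureTheory
open scoped NNReal ENNReal

namespace TwoFilter

variable {X : Type*} [MeasurableSpace X]

/-- A Markov transition density with respect to `lam`. -/
structure IsTransitionDensity (lam : Measure X) (p : X → X → ℝ≥0) : Prop where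
  measurable : Measurable (Function.uncurry p)
  lintegral_eq_one : ∀ x, ∫⁻ x', (p x x' : ℝ≥0∞) ∂lam = 1

/-- The Markov kernel `P(x, dx') = p(x, x') lam(dx')` with transition density `p`. -/
noncomputable def kernelOf (lam : Measure X) (p : X → X → ℝ≥0) (x : X) : Measure X :=
  lam.withDensity fun x' => (p x x' : ℝ≥0∞)

/-- A state space model: initial distribution `χ`, transition density `q` of the hidden chain with
respect to `lam`, and the positive functions `g t` (likelihoods of the observations). -/
structure StateSpaceModel (lam : Measure X) where
  χ : Measure X
  isProb_χ : IsProbabilityMeasure χ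
  q : X → X → ℝ≥0
  isTransitionDensity_q : IsTransitionDensity lam q
  g : ℕ → X → ℝ≥0
  measurable_g : ∀ t, Measurable (g t)
  g_pos : ∀ t x, 0 < g t x

/-- The iterated integral
`f_t(x_t) ∫ Q(x_t, dx_{t+1}) f_{t+1}(x_{t+1}) ⋯ ∫ Q(x_{t+n-1}, dx_{t+n}) f_{t+n}(x_{t+n})`,
where `Q` has transition density `q`, as a function of `x_t = x`. -/
noncomputable def pathIntegral (lam : Measure X) (q : X → X → ℝ≥0) (f : ℕ → X → ℝ) :
    ℕ → ℕ → X → ℝ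
  | 0, t, x => f t x
  | n + 1, t, x => f t x * ∫ x', pathIntegral lam q f n (t + 1) x' ∂(kernelOf lam q x)

/-- The marginal smoothing distribution `φ_{χ, s|T}` applied to `h`:
`∫ χ(dx_0) g_0(x_0) ∏_{u=1}^T Q(x_{u-1}, dx_u) g_u(x_u) h(x_s)` divided by the same integral
without `h`. -/
noncomputable def StateSpaceModel.smoothing {lam : Measure X} (M : StateSpaceModel lam)
    (T s : ℕ) (h : X → ℝ) : ℝ :=
  (∫ x, pathIntegral lam M.q (fun u y => (M.g u y : ℝ) * if u = s then h y else 1) T 0 x ∂M.χ) /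
    ∫ x, pathIntegral lam M.q (fun u y => (M.g u y : ℝ)) T 0 x ∂M.χ

/-- The design parameters of the forward auxiliary particle filter: instrumental initial
distribution `ρ`, adjustment multiplier weights `ϑ t` and proposal densities `p t` (`t ≥ 1`). -/
structure ForwardFilter {lam : Measure X} (M : StateSpaceModel lam) where
  ρ : Measure X
  isProb_ρ : IsProbabilityMeasure ρ
  χ_ac : M.χ ≪ ρ
  ϑ : ℕ → X → ℝ≥0
  measurable_ϑ : ∀ t, Measurable (ϑ t)
  p : ℕ → X → X → ℝ≥0
  isTransitionDensity_p : ∀ t, IsTransitionDensity lam (p t)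

/-- The design parameters of the backward information filter with final time `T`: the positive
functions `γ t` (possibly improper prior densities), the instrumental density `ρ` at time `T`, the
adjustment weights `ϑ t` and the proposal densities `p t`. -/
structure BackwardFilter {lam : Measure X} (M : StateSpaceModel lam) (T : ℕ) where
  γ : ℕ → X → ℝ≥0
  measurable_γ : ∀ t, Measurable (γ t)
  γ_pos : ∀ t x, 0 < γ t x
  /-- `∫ γ_t(x_t) dx_t [∏_{u=t+1}^T g_{u-1}(x_{u-1}) Q(x_{u-1}, dx_u)] g_T(x_T) < ∞` -/
  integrable_γ : ∀ t ≤ T, Integrable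
    (fun x => (γ t x : ℝ) * pathIntegral lam M.q (fun u y => (M.g u y : ℝ)) (T - t) t x) lam
  ρ : X → ℝ≥0
  measurable_ρ : Measurable ρ
  lintegral_ρ : ∫⁻ x, (ρ x : ℝ≥0∞) ∂lam = 1
  ϑ : ℕ → X → ℝ≥0
  measurable_ϑ : ∀ t, Measurable (ϑ t)
  p : ℕ → X → X → ℝ≥0
  isTransitionDensity_p : ∀ t, IsTransitionDensity lam (p t)

/-- A weighted sample: `N` particles with nonnegative weights; `(S i).1` is the position and
`(S i).2` the unnormalized weight of particle `i`. -/
abbrev WeightedSample (X : Type*) (N : ℕ) := Fin N → X × ℝ≥0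

/-- Normalized weights `w i / ∑ j, w j`. If all the weights vanish, the uniform weights `1 / N`
are used. -/
noncomputable def normalized {N : ℕ} (w : Fin N → ℝ≥0) (i : Fin N) : ℝ≥0 :=
  if ∑ j, w j = 0 then (N : ℝ≥0)⁻¹ else w i / ∑ j, w j

/-- The self-normalized estimator `∑ i, (w i / ∑ j, w j) * h (ξ i)`. -/
noncomputable def estimate {N : ℕ} (w : Fin N → ℝ≥0) (ξ : Fin N → X) (h : X → ℝ) : ℝ :=
  ∑ i, (normalized w i : ℝ) * h (ξ i)

/-- The law of `N` i.i.d. particles drawn from `ρ`, with weights `ω₀`. -/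
noncomputable def initialLaw (N : ℕ) (ρ : Measure X) (ω₀ : X → ℝ≥0) :
    Measure (WeightedSample X N) :=
  Measure.pi fun _ => ρ.map fun x => (x, ω₀ x)

/-- The instrumental distribution on `{1, …, N} × X`: given the weighted sample
`S = (ξ i, w i)`, its density is proportional to `(i, x) ↦ w i * v (ξ i) * p (ξ i) x`. -/
noncomputable def instrumental (lam : Measure X) (v : X → ℝ≥0) (p : X → X → ℝ≥0) {N : ℕ}
    (S : WeightedSample X N) : Measure (Fin N × X) :=
  ∑ i, (normalized (fun j => (S j).2 * v (S j).1) i) •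
    (Measure.dirac i).prod (kernelOf lam p (S i).1)

/-- The conditional law of the new weighted sample given the current one `S = (ξ i, w i)`:
`N` independent pairs `(I, x)` are drawn from the instrumental distribution, and the new particle
`x` receives the weight `ω (ξ I) x`. -/
noncomputable def stepLaw (lam : Measure X) (v : X → ℝ≥0) (p ω : X → X → ℝ≥0) {N : ℕ}
    (S : WeightedSample X N) : Measure (WeightedSample X N) :=
  Measure.pi fun _ => (instrumental lam v p S).map fun d => (d.2, ω (S d.1).1 d.2)

section Filters

variable {lam : Measure X} {M : StateSpaceModel lam} {T : ℕ}

/-- `ω_0(x) = (dχ/dρ_0)(x) g_0(x)`. -/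
noncomputable def ForwardFilter.weightInit (F : ForwardFilter M) (x : X) : ℝ≥0 :=
  (M.χ.rnDeriv F.ρ x).toNNReal * M.g 0 x

/-- `ω_t(x, x') = q(x, x') g_t(x') / (ϑ_t(x) p_t(x, x'))`. -/
noncomputable def ForwardFilter.weight (F : ForwardFilter M) (t : ℕ) (x x' : X) : ℝ≥0 :=
  M.q x x' * M.g t x' / (F.ϑ t x * F.p t x x')

/-- The law of the weighted sample `(ξ_s^i, ω_s^i)_{i ≤ N}` of the forward filter at time `s`. -/
noncomputable def ForwardFilter.law (F : ForwardFilter M) (N : ℕ) :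
    ℕ → Measure (WeightedSample X N)
  | 0 => initialLaw N F.ρ F.weightInit
  | s + 1 => (ForwardFilter.law F N s).bind
      (stepLaw lam (F.ϑ (s + 1)) (F.p (s + 1)) (F.weight (s + 1)))

/-- The weight `g_T(x) γ_T(x) / ρ(x)` of the backward filter at time `T`. -/
noncomputable def BackwardFilter.weightInit (G : BackwardFilter M T) (x : X) : ℝ≥0 :=
  M.g T x * G.γ T x / G.ρ x

/-- The weight at time `t < T` of a particle `x` whose ancestor at time `t + 1` is `x'`:
`γ_t(x) g_t(x) q(x, x') / (ϑ_t(x') p_t(x', x))`. -/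
noncomputable def BackwardFilter.weight (G : BackwardFilter M T) (t : ℕ) (x' x : X) : ℝ≥0 :=
  G.γ t x * M.g t x * M.q x x' / (G.ϑ t x' * G.p t x' x)

/-- The law of the weighted sample of the backward information filter at time `T - n`. -/
noncomputable def BackwardFilter.lawAux (G : BackwardFilter M T) (N : ℕ) :
    ℕ → Measure (WeightedSample X N)
  | 0 => initialLaw N (lam.withDensity fun x => (G.ρ x : ℝ≥0∞)) G.weightInit
  | n + 1 => (BackwardFilter.lawAux G N n).bind
      (stepLaw lam (fun x' => G.ϑ (T - (n + 1)) x' / G.γ (T - (n + 1) + 1) x')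
        (G.p (T - (n + 1))) (G.weight (T - (n + 1))))

/-- The law of the weighted sample of the backward information filter at time `t ≤ T`. -/
noncomputable def BackwardFilter.law (G : BackwardFilter M T) (N t : ℕ) :
    Measure (WeightedSample X N) :=
  G.lawAux N (T - t)

/-- The weights of the reweighted forward particles at time `s`, computed from the forward sample
`S` at time `s` and the backward sample `S'` at time `s + 1`:
`ω_s^i ∑_j ω̌_{s+1|T}^j q(ξ_s^i, ξ̌_{s+1|T}^j) / γ_{s+1}(ξ̌_{s+1|T}^j)`. -/
noncomputable def BackwardFilter.forwardSmoothingWeight (G : BackwardFilter M T) (s : ℕ) {N : ℕ}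
    (S S' : WeightedSample X N) (i : Fin N) : ℝ≥0 :=
  (S i).2 * ∑ j, (S' j).2 * M.q (S i).1 (S' j).1 / G.γ (s + 1) (S' j).1

/-- The weights of the reweighted backward particles at time `s`, computed from the forward sample
`S` at time `s - 1` and the backward sample `S'` at time `s`:
`ω̌_{s|T}^j ∑_i ω_{s-1}^i q(ξ_{s-1}^i, ξ̌_{s|T}^j) / γ_s(ξ̌_{s|T}^j)`. -/
noncomputable def BackwardFilter.backwardSmoothingWeight (G : BackwardFilter M T) (s : ℕ) {N : ℕ}
    (S S' : WeightedSample X N) (j : Fin N) : ℝ≥0 :=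
  (S' j).2 * ∑ i, (S i).2 * M.q (S i).1 (S' j).1 / G.γ s (S' j).1

/-- A1: `q` and `g_t`, `0 ≤ t ≤ T`, are bounded (positivity of `g_t` is part of the model). -/
structure AssumptionA1 (M : StateSpaceModel lam) (T : ℕ) : Prop where
  q_bdd : ∃ K : ℝ≥0, ∀ x x', M.q x x' ≤ K
  g_bdd : ∀ t ≤ T, ∃ K : ℝ≥0, ∀ x, M.g t x ≤ K

/-- A2: `ϑ_t`, `p_t` and the importance weight functions are bounded. For a quotient `a / b`,
boundedness is written `a ≤ K * b`, so that it fails where `b = 0 < a`. The function `ω_0` is only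
defined up to null sets of the initial instrumental distribution. -/
structure AssumptionA2 (F : ForwardFilter M) (T : ℕ) : Prop where
  ϑ_bdd : ∀ t, 1 ≤ t → t ≤ T → ∃ K : ℝ≥0, ∀ x, F.ϑ t x ≤ K
  p_bdd : ∀ t, 1 ≤ t → t ≤ T → ∃ K : ℝ≥0, ∀ x x', F.p t x x' ≤ K
  weightInit_bdd : ∃ K : ℝ≥0, ∀ᵐ x ∂F.ρ, F.weightInit x ≤ K
  weight_bdd : ∀ t, 1 ≤ t → t ≤ T → ∃ K : ℝ≥0, ∀ x x',
    M.q x x' * M.g t x' ≤ K * (F.ϑ t x * F.p t x x')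

/-- A3, restricted to the objects of the two filters: `ϑ_t / γ_{t+1}`, `p_t` and the importance
weight functions of the backward filter are bounded, and `q(x, x') / γ_{t+1}(x')` is bounded for
`1 ≤ t ≤ T - 1`. -/
structure AssumptionA3 (G : BackwardFilter M T) : Prop where
  ϑ_bdd : ∀ t < T, ∃ K : ℝ≥0, ∀ x, G.ϑ t x / G.γ (t + 1) x ≤ K
  p_bdd : ∀ t < T, ∃ K : ℝ≥0, ∀ x x', G.p t x x' ≤ K
  weightInit_bdd : ∃ K : ℝ≥0, ∀ x, M.g T x * G.γ T x ≤ K * G.ρ x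
  weight_bdd : ∀ t < T, ∃ K : ℝ≥0, ∀ x x',
    G.γ t x * M.g t x * M.q x x' ≤ K * (G.ϑ t x' * G.p t x' x)
  q_bdd : ∀ t, 1 ≤ t → t < T → ∃ K : ℝ≥0, ∀ x x', M.q x x' / G.γ (t + 1) x' ≤ K

end Filters

/-- The oscillation `sup_{z, z'} |h z - h z'|`. -/
noncomputable def osc (h : X → ℝ) : ℝ := ⨆ z : X × X, |h z.1 - h z.2|

/-- `B exp (- C N ε² / osc(h)²)`, read as `0` if `osc(h) = 0`. -/
noncomputable def hoeffdingBound (B C : ℝ) (N : ℕ) (ε : ℝ) (h : X → ℝ) : ℝ :=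
  if osc h = 0 then 0 else B * Real.exp (-C * N * ε ^ 2 / osc h ^ 2)

/-! The laws above are well defined: the conditional law of a step is a probability measure that
depends measurably on the current sample. -/

lemma sum_normalized {N : ℕ} (hN : 1 ≤ N) (w : Fin N → ℝ≥0) : ∑ i, normalized w i = 1 := by
  unfold normalized
  split_ifs with h
  · have : (N : ℝ≥0) ≠ 0 := by positivity
    simp [this]
  · rw [← Finset.sum_div, div_self h]

lemma measurable_normalized {N : ℕ} (i : Fin N) :
    Measurable fun w : Fin N → ℝ≥0 => normalized w i := by
  unfold normalized
  refine Measurable.ite ?_ measurable_const (by fun_prop)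
  exact measurableSet_eq_fun (by fun_prop) measurable_const

lemma isProbabilityMeasure_kernelOf {lam : Measure X} {p : X → X → ℝ≥0}
    (hp : IsTransitionDensity lam p) (x : X) : IsProbabilityMeasure (kernelOf lam p x) :=
  ⟨by rw [kernelOf, withDensity_apply _ MeasurableSet.univ, Measure.restrict_univ,
    hp.lintegral_eq_one]⟩

lemma isProbabilityMeasure_instrumental {lam : Measure X} {p : X → X → ℝ≥0}
    (hp : IsTransitionDensity lam p) (v : X → ℝ≥0) {N : ℕ} (hN : 1 ≤ N)
    (S : WeightedSample X N) : IsProbabilityMeasure (instrumental lam v p S) := by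
  have := fun x => isProbabilityMeasure_kernelOf hp x
  refine ⟨?_⟩
  have h := sum_normalized hN (fun j => (S j).2 * v (S j).1)
  simp only [instrumental, Measure.coe_finsetSum, Finset.sum_apply, Measure.smul_apply,
    measure_univ, ENNReal.smul_def, smul_eq_mul, mul_one]
  exact_mod_cast h

lemma measurable_attach {N : ℕ} {ω : X → X → ℝ≥0} (hω : Measurable (Function.uncurry ω)) :
    Measurable fun a : WeightedSample X N × (Fin N × X) =>
      ((a.2.2, ω (a.1 a.2.1).1 a.2.2) : X × ℝ≥0) := by
  have h1 : Measurable fun a : WeightedSample X N × (Fin N × X) => a.1 a.2.1 := by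
    have : Measurable fun a : Fin N × (WeightedSample X N × X) => a.2.1 a.1 :=
      measurable_from_prod_countable_right fun i =>
        (measurable_pi_apply i).comp measurable_fst
    exact this.comp (by fun_prop : Measurable fun a : WeightedSample X N × (Fin N × X) =>
      (a.2.1, (a.1, a.2.2)))
  exact (by fun_prop : Measurable fun a : WeightedSample X N × (Fin N × X) => a.2.2).prodMk
    (hω.comp (h1.fst.prodMk (by fun_prop)))

lemma isProbabilityMeasure_stepLaw {lam : Measure X} {p ω : X → X → ℝ≥0}
    (hp : IsTransitionDensity lam p) (hω : Measurable (Function.uncurry ω)) (v : X → ℝ≥0) {N : ℕ}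
    (hN : 1 ≤ N) (S : WeightedSample X N) : IsProbabilityMeasure (stepLaw lam v p ω S) := by
  have := isProbabilityMeasure_instrumental hp v hN S
  have h : Measurable fun d : Fin N × X => ((d.2, ω (S d.1).1 d.2) : X × ℝ≥0) :=
    (measurable_attach hω).comp (measurable_prodMk_left (x := S))
  have := fun _ : Fin N => Measure.isProbabilityMeasure_map
    (μ := instrumental lam v p S) h.aemeasurable
  unfold stepLaw
  infer_instance

lemma measurable_stepLaw {lam : Measure X} [SFinite lam] {v : X → ℝ≥0} {p ω : X → X → ℝ≥0}
    (hv : Measurable v) (hp : IsTransitionDensity lam p)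
    (hω : Measurable (Function.uncurry ω)) {N : ℕ} (hN : 1 ≤ N) :
    Measurable (stepLaw lam v p ω (N := N)) := by
  have hpr := fun S => isProbabilityMeasure_stepLaw (N := N) hp hω v hN S
  have hin := fun S => isProbabilityMeasure_instrumental (N := N) hp v hN S
  have hk := fun x => isProbabilityMeasure_kernelOf hp x
  have hatt : ∀ S : WeightedSample X N,
      Measurable fun d : Fin N × X => ((d.2, ω (S d.1).1 d.2) : X × ℝ≥0) := fun S =>
    (measurable_attach hω).comp (measurable_prodMk_left (x := S))
  have hprm := fun S => Measure.isProbabilityMeasure_map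
    (μ := instrumental lam v p S) (hatt S).aemeasurable
  refine Measurable.measure_of_isPiSystem_of_isProbabilityMeasure generateFrom_pi.symm
    isPiSystem_pi ?_
  rintro _ ⟨A, hA, rfl⟩
  simp only [Set.mem_univ_pi, Set.mem_ofPred_eq] at hA
  simp only [stepLaw, Measure.pi_pi]
  refine Finset.measurable_fun_prod _ fun l _ => ?_
  have key : ∀ S : WeightedSample X N,
      ((instrumental lam v p S).map fun d => ((d.2, ω (S d.1).1 d.2) : X × ℝ≥0)) (A l) =
      ∑ i, (normalized (fun j => (S j).2 * v (S j).1) i : ℝ≥0∞) *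
        ∫⁻ x, (A l).indicator (fun _ => 1) ((x, ω (S i).1 x) : X × ℝ≥0) * p (S i).1 x ∂lam := by
    intro S
    rw [Measure.map_apply (hatt S) (hA l)]
    simp only [instrumental, Measure.coe_finsetSum, Finset.sum_apply, Measure.smul_apply,
      ENNReal.smul_def, smul_eq_mul]
    refine Finset.sum_congr rfl fun i _ => ?_
    congr 1
    have hωi : Measurable fun x => ((x, ω (S i).1 x) : X × ℝ≥0) :=
      measurable_id.prodMk (hω.comp (measurable_prodMk_left (x := (S i).1)))
    rw [Measure.dirac_prod, Measure.map_apply measurable_prodMk_left (hatt S (hA l)), kernelOf,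
      withDensity_apply _ (measurable_prodMk_left (hatt S (hA l))),
      ← lintegral_indicator (measurable_prodMk_left (hatt S (hA l)))]
    refine lintegral_congr fun x => ?_
    by_cases hx : (x, ω (S i).1 x) ∈ A l <;> simp [Set.indicator, hx]
  simp only [key]
  refine Finset.measurable_fun_sum _ fun i _ => Measurable.mul ?_ ?_
  · have : Measurable fun S : WeightedSample X N => normalized (fun j => (S j).2 * v (S j).1) i :=
      (measurable_normalized i).comp (by fun_prop)
    exact this.coe_nnreal_ennreal
  · refine Measurable.lintegral_prod_right' (f := fun a : WeightedSample X N × X =>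
      (A l).indicator (fun _ => (1 : ℝ≥0∞)) ((a.2, ω (a.1 i).1 a.2) : X × ℝ≥0) *
        p (a.1 i).1 a.2) ?_
    have h0 : Measurable fun a : WeightedSample X N × X => ((a.1 i).1, a.2) := by fun_prop
    refine Measurable.mul ?_ (hp.measurable.comp h0).coe_nnreal_ennreal
    exact (measurable_const.indicator (hA l)).comp (measurable_snd.prodMk (hω.comp h0))

end TwoFilter

namespace TwoFilter

open ProbabilityTheory

variable {X : Type*} [MeasurableSpace X]

/-! ### Hoeffding's inequality for the empirical mean -/

/-! Every random quantity here is a quotient of unnormalized averages of bounded functions, and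
sub-Gaussian tails survive the few operations that produce it. The invariant is `Concentrates`:
bounded weights, and a deviation inequality for `N⁻¹ ∑ wᵢ h(ξᵢ)` around `∫ h dμ` with constants
independent of `N` and of `h` once `h` is scaled by its sup norm. This uniformity in `h` is what
lets the inequality be applied to functions built from `h` or from another sample.

An i.i.d. sample has this property by Hoeffding. One filter step preserves it (`concentrates_step`):
given the current sample the new pairs are i.i.d., so their average is close to its conditional
mean. That mean is a quotient of two averages of the current sample, and `abs_sub_div_lt` controls
it. The limit measure is pushed through the kernel `v p ω` up to a constant. The importance weights
are designed so that this product does not depend on the proposals: the forward targets are the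
filter measures, and the backward targets have density `γ_t β_t`, where `β_t` is the backward
function.

For two independent samples, freezing one of them gives concentration of double averages
(`Concentrates.deviation_prod`). Both estimators are quotients of double averages with kernel `q /
γ`. The factor `γ` cancels against the backward target and the unknown constants cancel in the
quotient, which leaves the smoothing distribution. Centring `h` finally replaces the sup norm by the
oscillation. -/

lemma hoeffding_pi {Y : Type*} [MeasurableSpace Y] {ν : Measure Y} [IsProbabilityMeasure ν]
    {f : Y → ℝ} (hf : Measurable f) {M : ℝ} (hM : 0 < M) (hb : ∀ᵐ y ∂ν, |f y| ≤ M)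
    {N : ℕ} (hN : 1 ≤ N) {ε : ℝ} (hε : 0 < ε) :
    (Measure.pi fun _ : Fin N => ν) {y | ε ≤ |(N : ℝ)⁻¹ * ∑ i, f (y i) - ∫ a, f a ∂ν|} ≤
      ENNReal.ofReal (2 * Real.exp (-(1 / 2) * N * (ε / M) ^ 2)) := by
  have hN0 : (0 : ℝ) < N := by exact_mod_cast hN
  -- One-sided bound, used for `f` and for `-f`. A variable with values in `[-M, M]` has variance
  -- proxy `M²`.
  have hone : ∀ (f : Y → ℝ), Measurable f → (∀ᵐ y ∂ν, |f y| ≤ M) →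
      (Measure.pi fun _ : Fin N => ν).real
        {y | N * ε ≤ ∑ i, (f (y i) - ∫ a, f a ∂ν)} ≤
      Real.exp (-(1 / 2) * N * (ε / M) ^ 2) := by
    intro f hf hb
    have hind : iIndepFun (fun (i : Fin N) (y : Fin N → Y) => f (y i) - ∫ a, f a ∂ν)
        (Measure.pi fun _ : Fin N => ν) :=
      iIndepFun_pi (X := fun _ a => f a - ∫ a, f a ∂ν) fun _ =>
        (hf.sub_const _).aemeasurable
    have hsub : ∀ i ∈ (Finset.univ : Finset (Fin N)),
        HasSubgaussianMGF (fun y : Fin N → Y => f (y i) - ∫ a, f a ∂ν)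
          ((‖M - -M‖₊ / 2) ^ 2) (Measure.pi fun _ : Fin N => ν) := by
      intro i _
      have h0 := hasSubgaussianMGF_of_mem_Icc (μ := ν) (a := -M) (b := M) hf.aemeasurable
        (hb.mono fun y hy => abs_le.1 hy)
      have hmap : (Measure.pi fun _ : Fin N => ν).map (Function.eval i) = ν :=
        (measurePreserving_eval (fun _ : Fin N => ν) i).map_eq
      have h1 := HasSubgaussianMGF.of_map (Y := Function.eval i)
        (μ := Measure.pi fun _ : Fin N => ν)
        (X := fun a => f a - ∫ a, f a ∂ν) (c := (‖M - -M‖₊ / 2) ^ 2)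
        (measurable_pi_apply i).aemeasurable (by rw [hmap]; exact h0)
      exact h1
    have := HasSubgaussianMGF.measure_sum_ge_le_of_iIndepFun hind hsub
      (ε := N * ε) (by positivity)
    refine this.trans (le_of_eq ?_)
    congr 1
    have hc : (((‖M - -M‖₊ / 2) ^ 2 : ℝ≥0) : ℝ) = M ^ 2 := by
      have : M - -M = 2 * M := by ring
      rw [this]
      simp [abs_of_pos hM]
    simp only [Finset.sum_const, Finset.card_univ, Fintype.card_fin, nsmul_eq_mul]
    push_cast at hc ⊢
    rw [hc]
    field_simp
  have h1 := hone f hf hb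
  have h2 := hone (fun y => -f y) hf.neg (by simpa using hb)
  have hsub : {y : Fin N → Y | ε ≤ |(N : ℝ)⁻¹ * ∑ i, f (y i) - ∫ a, f a ∂ν|} ⊆
      {y | N * ε ≤ ∑ i, (f (y i) - ∫ a, f a ∂ν)} ∪
      {y | N * ε ≤ ∑ i, (-f (y i) - ∫ a, -f a ∂ν)} := by
    intro y hy
    have key : ∀ c : ℝ, ∑ i : Fin N, (f (y i) - c) = N * ((N : ℝ)⁻¹ * ∑ i, f (y i) - c) := by
      intro c
      rw [Finset.sum_sub_distrib]
      simp
      field_simp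
    have key2 : ∑ i : Fin N, (-f (y i) - ∫ a, -f a ∂ν) =
        -(N * ((N : ℝ)⁻¹ * ∑ i, f (y i) - ∫ a, f a ∂ν)) := by
      rw [← key, integral_neg, ← Finset.sum_neg_distrib]
      exact Finset.sum_congr rfl fun i _ => by ring
    simp only [Set.mem_union, Set.mem_ofPred_eq, key, key2] at hy ⊢
    rcases le_abs.1 hy with h | h
    · left; gcongr
    · right
      rw [← mul_neg]; gcongr
  refine (measure_mono hsub).trans ((measure_union_le _ _).trans ?_)
  rw [two_mul, ENNReal.ofReal_add (Real.exp_pos _).le (Real.exp_pos _).le]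
  refine add_le_add ?_ ?_
  · rw [← ofReal_measureReal]; exact ENNReal.ofReal_le_ofReal h1
  · rw [← ofReal_measureReal]; exact ENNReal.ofReal_le_ofReal h2

/-! ### Exponential tails -/

/-- The sub-Gaussian tail `B exp (- C N r²)`. -/
noncomputable def tail (B C : ℝ) (N : ℕ) (r : ℝ) : ℝ≥0∞ :=
  ENNReal.ofReal (B * Real.exp (-C * N * r ^ 2))

/-- A fixed factor lost in the deviation only costs a factor in the rate, so all such losses can be
collected in `C`. -/
lemma tail_mul (B C : ℝ) (N : ℕ) (κ r : ℝ) : tail B C N (κ * r) = tail B (C * κ ^ 2) N r := by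
  unfold tail
  congr 3
  ring

lemma tail_add_le {B₁ B₂ : ℝ} (hB₁ : 0 ≤ B₁) (hB₂ : 0 ≤ B₂) (C₁ C₂ : ℝ) (N : ℕ) (r : ℝ) :
    tail B₁ C₁ N r + tail B₂ C₂ N r ≤ tail (B₁ + B₂) (min C₁ C₂) N r := by
  unfold tail
  rw [← ENNReal.ofReal_add (by positivity) (by positivity), add_mul]
  have : (0 : ℝ) ≤ N := N.cast_nonneg
  refine ENNReal.ofReal_le_ofReal (add_le_add ?_ ?_)
  · gcongr; exact min_le_left _ _
  · gcongr; exact min_le_right _ _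

/-! ### Weighted averages -/

/-- The weighted average `N⁻¹ ∑ i, w i * h (ξ i)`. -/
noncomputable def avg {X : Type*} {N : ℕ} (S : WeightedSample X N) (h : X → ℝ) : ℝ :=
  (N : ℝ)⁻¹ * ∑ i, ((S i).2 : ℝ) * h (S i).1

lemma measurable_avg {Y : Type*} [MeasurableSpace Y] {N : ℕ} {S : Y → WeightedSample X N}
    (hS : Measurable S) {f : Y → X → ℝ} (hf : Measurable (Function.uncurry f)) :
    Measurable fun y => avg (S y) (f y) := by
  unfold avg
  have h1 : ∀ i, Measurable fun y => S y i := fun i => (measurable_pi_apply i).comp hS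
  refine measurable_const.mul (Finset.measurable_fun_sum _ fun i _ => ?_)
  exact (h1 i).snd.coe_nnreal_real.mul (hf.comp (measurable_id.prodMk (h1 i).fst))

lemma abs_avg_le {X : Type*} {N : ℕ} {S : WeightedSample X N} {h : X → ℝ} {K : ℝ≥0} {M : ℝ} (hM : 0 ≤ M)
    (hS : ∀ i, (S i).2 ≤ K) (hh : ∀ x, |h x| ≤ M) : |avg S h| ≤ K * M := by
  unfold avg
  rcases Nat.eq_zero_or_pos N with rfl | hN
  · simp; positivity
  have hN0 : (0 : ℝ) < N := by exact_mod_cast hN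
  rw [abs_mul, abs_of_nonneg (by positivity), inv_mul_le_iff₀ hN0]
  refine (Finset.abs_sum_le_sum_abs _ _).trans ?_
  have : ∀ i ∈ (Finset.univ : Finset (Fin N)), |((S i).2 : ℝ) * h (S i).1| ≤ K * M := by
    intro i _
    rw [abs_mul, NNReal.abs_eq]
    exact mul_le_mul (by exact_mod_cast hS i) (hh _) (abs_nonneg _) K.2
  refine (Finset.sum_le_sum this).trans ?_
  simp

/-- If the total vanishes then so does each weight, so this product form holds under the `1 / N`
convention as well, unlike the quotient form. -/
lemma normalized_mul_sum {N : ℕ} (w : Fin N → ℝ≥0) (i : Fin N) :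
    normalized w i * ∑ j, w j = w i := by
  unfold normalized
  split_ifs with h
  · rw [h, mul_zero]
    exact (Finset.sum_eq_zero_iff.1 h i (Finset.mem_univ i)).symm
  · exact div_mul_cancel₀ _ h

lemma sum_normalized_mul_sum {N : ℕ} (w : Fin N → ℝ≥0) (a : Fin N → ℝ) :
    (∑ i, (normalized w i : ℝ) * a i) * ∑ j, (w j : ℝ) = ∑ i, (w i : ℝ) * a i := by
  rw [Finset.sum_mul]
  refine Finset.sum_congr rfl fun i _ => ?_
  rw [mul_right_comm]
  congr 1
  exact_mod_cast normalized_mul_sum w i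

lemma abs_sum_normalized_le {N : ℕ} (hN : 1 ≤ N) (w : Fin N → ℝ≥0) {a : Fin N → ℝ} {M : ℝ}
    (ha : ∀ i, |a i| ≤ M) : |∑ i, (normalized w i : ℝ) * a i| ≤ M := by
  have h1 : ∑ i, (normalized w i : ℝ) = 1 := by exact_mod_cast sum_normalized hN w
  calc |∑ i, (normalized w i : ℝ) * a i| ≤ ∑ i, |(normalized w i : ℝ) * a i| :=
        Finset.abs_sum_le_sum_abs _ _
    _ ≤ ∑ i, (normalized w i : ℝ) * M := by
        refine Finset.sum_le_sum fun i _ => ?_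
        rw [abs_mul, NNReal.abs_eq]
        exact mul_le_mul_of_nonneg_left (ha i) (NNReal.coe_nonneg _)
    _ = M := by rw [← Finset.sum_mul, h1, one_mul]

/-- Deviations of the quotient `m = a / b` are controlled by those of `a` and `b`. The hypothesis
`m * b = a` leaves `m` free where `b` vanishes. -/
lemma abs_sub_div_lt {m a b a' b' D δ : ℝ} (hm : m * b = a) (hD : 0 < D) (hmD : |m| ≤ D)
    (hb' : 0 < b') (ha : |a - a'| < b' * δ / 2) (hb : |b - b'| < b' * δ / (2 * D)) :
    |m - a' / b'| < δ := by
  -- Only the deterministic limit `b'` is divided by, never the random `b`; hence no lower bound on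
  -- `b` is needed.
  have h1 : m - a' / b' = ((a - a') - m * (b - b')) / b' := by
    field_simp
    rw [← hm]; ring
  rw [h1, abs_div, abs_of_pos hb', div_lt_iff₀ hb']
  have h2 : |m * (b - b')| ≤ b' * δ / 2 := by
    rw [abs_mul]
    calc |m| * |b - b'| ≤ D * (b' * δ / (2 * D)) :=
          mul_le_mul hmD hb.le (abs_nonneg _) hD.le
      _ = b' * δ / 2 := by field_simp
  calc |a - a' - m * (b - b')| ≤ |a - a'| + |m * (b - b')| := abs_sub _ _
    _ < b' * δ / 2 + b' * δ / 2 := add_lt_add_of_lt_of_le ha h2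
    _ = δ * b' := by ring

/-! ### Concentrating weighted samples -/

/-- The weighted samples with laws `L N` have bounded weights, and their weighted averages satisfy
an exponential deviation inequality around the finite measure `μ`. -/
structure Concentrates (L : ∀ N : ℕ, Measure (WeightedSample X N)) (μ : Measure X) : Prop where
  isFinite : IsFiniteMeasure μ
  isProb : ∀ N, 1 ≤ N → IsProbabilityMeasure (L N)
  weight_le : ∃ K : ℝ≥0, 0 < K ∧ ∀ N, 1 ≤ N → ∀ᵐ S ∂L N, ∀ i, (S i).2 ≤ K
  deviation : ∃ B C : ℝ, 0 < B ∧ 0 < C ∧ ∀ N, 1 ≤ N → ∀ ε : ℝ, 0 < ε → ∀ h : X → ℝ, Measurable h →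
    ∀ M : ℝ, 0 < M → (∀ x, |h x| ≤ M) →
      L N {S | ε ≤ |avg S h - ∫ x, h x ∂μ|} ≤ tail B C N (ε / M)

lemma integrable_of_abs_le {μ : Measure X} [IsFiniteMeasure μ] {h : X → ℝ} (hh : Measurable h)
    {M : ℝ} (hM : ∀ x, |h x| ≤ M) : Integrable h μ :=
  Integrable.of_bound hh.aestronglyMeasurable M (ae_of_all _ hM)

lemma abs_integral_le {μ : Measure X} [IsFiniteMeasure μ] {h : X → ℝ}
    {M : ℝ} (hM : ∀ x, |h x| ≤ M) : |∫ x, h x ∂μ| ≤ μ.real Set.univ * M := by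
  have := norm_integral_le_of_norm_le_const (μ := μ) (f := h) (C := M) (ae_of_all _ hM)
  rwa [mul_comm] at this

lemma integral_withDensity_coe {μ : Measure X} {f : X → ℝ≥0} (hf : Measurable f) (h : X → ℝ) :
    ∫ x, h x ∂(μ.withDensity fun x => (f x : ℝ≥0∞)) = ∫ x, (f x : ℝ) * h x ∂μ :=
  integral_withDensity_eq_integral_smul hf h

lemma isFiniteMeasure_withDensity_of_le {μ : Measure X} [IsFiniteMeasure μ] {f : X → ℝ≥0} {K : ℝ≥0}
    (hK : ∀ᵐ x ∂μ, f x ≤ K) : IsFiniteMeasure (μ.withDensity fun x => (f x : ℝ≥0∞)) := by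
  refine isFiniteMeasure_withDensity (ne_top_of_le_ne_top
    (b := ∫⁻ _, (K : ℝ≥0∞) ∂μ) ?_ (lintegral_mono_ae (hK.mono fun x hx => by exact_mod_cast hx)))
  rw [lintegral_const]
  exact ENNReal.mul_ne_top ENNReal.coe_ne_top (measure_ne_top _ _)

/-- Weighted samples whose particles are i.i.d. concentrate. -/
lemma concentrates_initialLaw {ρ : Measure X} [IsProbabilityMeasure ρ] {ω : X → ℝ≥0}
    (hω : Measurable ω) {K : ℝ≥0} (hK : ∀ᵐ x ∂ρ, ω x ≤ K) :
    Concentrates (fun N => initialLaw N ρ ω) (ρ.withDensity fun x => (ω x : ℝ≥0∞)) := by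
  have hm : Measurable fun x => ((x, ω x) : X × ℝ≥0) := measurable_id.prodMk hω
  have := Measure.isProbabilityMeasure_map (μ := ρ) hm.aemeasurable
  -- `K + 1` instead of `K` keeps the bound strictly positive.
  have hK1 : ∀ᵐ y ∂(ρ.map fun x => ((x, ω x) : X × ℝ≥0)), y.2 ≤ K + 1 := by
    rw [ae_map_iff hm.aemeasurable (measurableSet_le measurable_snd measurable_const)]
    exact hK.mono fun x hx => hx.trans (by simp)
  refine ⟨isFiniteMeasure_withDensity_of_le hK, fun N _ => by unfold initialLaw; infer_instance,
    ⟨K + 1, by positivity, fun N _ => ?_⟩, 2, 1 / 2 * ((K + 1 : ℝ)⁻¹) ^ 2, by positivity,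
    by positivity, ?_⟩
  · unfold initialLaw
    rw [Filter.eventually_all]
    exact fun i => (Measure.tendsto_eval_ae_ae (μ := fun _ : Fin N =>
      ρ.map fun x => ((x, ω x) : X × ℝ≥0)) (i := i)).eventually hK1
  · intro N hN ε hε h hh M hM hb
    have hK0 : (0 : ℝ) < K + 1 := by positivity
    have := hoeffding_pi (ν := ρ.map fun x => ((x, ω x) : X × ℝ≥0))
      (f := fun y => (y.2 : ℝ) * h y.1) (by fun_prop) (M := (K + 1) * M) (by positivity)
      (hK1.mono fun y hy => by
        rw [abs_mul, NNReal.abs_eq]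
        exact mul_le_mul (by exact_mod_cast hy) (hb _) (abs_nonneg _) hK0.le) hN hε
    rw [integral_map hm.aemeasurable (by fun_prop)] at this
    rw [integral_withDensity_coe hω]
    refine this.trans (le_of_eq ?_)
    rw [← tail_mul, tail]
    congr 4
    field_simp

/-! ### Kernels with a density -/

/-- The kernel `x ↦ r(x, x') lam(dx')`. -/
noncomputable def densityKernel (lam : Measure X) [SFinite lam] (r : X → X → ℝ≥0) : Kernel X X :=
  Kernel.withDensity (Kernel.const X lam) fun x x' => (r x x' : ℝ≥0∞)

section DensityKernel

variable {lam : Measure X} [SFinite lam] {r : X → X → ℝ≥0}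

lemma densityKernel_apply (hr : Measurable (Function.uncurry r)) (x : X) :
    densityKernel lam r x = lam.withDensity fun x' => (r x x' : ℝ≥0∞) := by
  rw [densityKernel, Kernel.withDensity_apply, Kernel.const_apply]
  exact hr.coe_nnreal_ennreal

lemma isFiniteKernel_densityKernel (hr : Measurable (Function.uncurry r)) {K : ℝ≥0}
    (hK : ∀ x, ∫⁻ x', r x x' ∂lam ≤ K) : IsFiniteKernel (densityKernel lam r) :=
  ⟨K, ENNReal.coe_lt_top, fun x => by
    rw [densityKernel_apply hr, withDensity_apply _ MeasurableSet.univ, Measure.restrict_univ]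
    exact hK x⟩

lemma integral_densityKernel (hr : Measurable (Function.uncurry r)) (h : X → ℝ) (x : X) :
    ∫ x', h x' ∂(densityKernel lam r x) = ∫ x', (r x x' : ℝ) * h x' ∂lam := by
  rw [densityKernel_apply hr, integral_withDensity_coe]
  exact hr.comp measurable_prodMk_left

lemma lintegral_bind_densityKernel {μ : Measure X} (hr : Measurable (Function.uncurry r))
    {f : X → ℝ≥0∞} (hf : Measurable f) :
    ∫⁻ x, f x ∂(μ.bind (densityKernel lam r)) = ∫⁻ x, ∫⁻ x', r x x' * f x' ∂lam ∂μ := by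
  rw [Measure.lintegral_bind (Kernel.aemeasurable _) hf.aemeasurable]
  refine lintegral_congr fun x => ?_
  have h1 : Measurable fun x' => (r x x' : ℝ≥0∞) :=
    (hr.comp measurable_prodMk_left).coe_nnreal_ennreal
  rw [densityKernel_apply hr, lintegral_withDensity_eq_lintegral_mul _ h1 hf]
  rfl

end DensityKernel

lemma integral_bind_kernel {μ : Measure X} [IsFiniteMeasure μ] {κ : Kernel X X} [IsFiniteKernel κ]
    {h : X → ℝ} (hh : Measurable h) {M : ℝ} (hM : ∀ x, |h x| ≤ M) :
    ∫ x, h x ∂(μ.bind κ) = ∫ x, ∫ x', h x' ∂(κ x) ∂μ := by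
  have : IsFiniteMeasure (μ.compProd κ) := inferInstance
  rw [← Measure.snd_compProd, Measure.snd, integral_map measurable_snd.aemeasurable
    hh.aestronglyMeasurable, Measure.integral_compProd (f := fun y : X × X => h y.2)
      (Integrable.of_bound (hh.comp measurable_snd).aestronglyMeasurable M
        (ae_of_all _ fun x => hM _))]

lemma integral_coe_nnreal {μ : Measure X} {v : X → ℝ≥0} (hv : Measurable v) :
    ∫ x, (v x : ℝ) ∂μ = (∫⁻ x, v x ∂μ).toReal := by
  rw [integral_eq_lintegral_of_nonneg_ae (ae_of_all _ fun x => by positivity)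
    hv.coe_nnreal_real.aestronglyMeasurable]
  simp

lemma measurable_integral_mul {lam : Measure X} [SFinite lam] {f : X → X → ℝ}
    (hf : Measurable (Function.uncurry f)) : Measurable fun x => ∫ x', f x x' ∂lam :=
  (hf.stronglyMeasurable.integral_prod_right (ν := lam)).measurable

/-! ### One step of a particle filter -/

lemma integral_kernelOf {lam : Measure X} {p : X → X → ℝ≥0}
    (hp : IsTransitionDensity lam p) (h : X → ℝ) (x : X) :
    ∫ x', h x' ∂(kernelOf lam p x) = ∫ x', (p x x' : ℝ) * h x' ∂lam :=
  integral_withDensity_coe (hp.measurable.comp measurable_prodMk_left) h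

lemma abs_integral_kernelOf_le {lam : Measure X} {p : X → X → ℝ≥0}
    (hp : IsTransitionDensity lam p) {h : X → ℝ} {M : ℝ} (hM : ∀ x, |h x| ≤ M) (x : X) :
    |∫ x', h x' ∂(kernelOf lam p x)| ≤ M := by
  have := isProbabilityMeasure_kernelOf hp x
  simpa using abs_integral_le (μ := kernelOf lam p x) hM

lemma measurable_integral_kernelOf {lam : Measure X} [SFinite lam] {p : X → X → ℝ≥0}
    (hp : IsTransitionDensity lam p) {f : X → X → ℝ} (hf : Measurable (Function.uncurry f)) :
    Measurable fun x => ∫ x', f x x' ∂(kernelOf lam p x) := by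
  simp only [integral_kernelOf hp]
  exact measurable_integral_mul (hp.measurable.coe_nnreal_real.mul hf)

lemma integral_instrumental {lam : Measure X} {p : X → X → ℝ≥0}
    (hp : IsTransitionDensity lam p) (v : X → ℝ≥0) {N : ℕ} (S : WeightedSample X N)
    {f : Fin N × X → ℝ} (hf : Measurable f) {M : ℝ} (hM : ∀ y, |f y| ≤ M) :
    ∫ y, f y ∂(instrumental lam v p S) =
      ∑ i, (normalized (fun j => (S j).2 * v (S j).1) i : ℝ) *
        ∫ x, f (i, x) ∂(kernelOf lam p (S i).1) := by
  have := fun x => isProbabilityMeasure_kernelOf hp x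
  unfold instrumental
  rw [integral_finsetSum_measure]
  · refine Finset.sum_congr rfl fun i _ => ?_
    rw [integral_smul_nnreal_measure, Measure.dirac_prod,
      integral_map measurable_prodMk_left.aemeasurable hf.aestronglyMeasurable]
    rfl
  · exact fun i _ => Integrable.of_bound hf.aestronglyMeasurable M (ae_of_all _ hM)

/-- Supplies the hypothesis `m * b = a` of `abs_sub_div_lt` when `m` is the conditional mean of the
new average given `S`. -/
lemma avg_mul_sum_normalized {X : Type*} {N : ℕ} (S : WeightedSample X N) (v : X → ℝ≥0) (a : X → ℝ) :
    (∑ i, (normalized (fun j => (S j).2 * v (S j).1) i : ℝ) * a (S i).1) *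
      avg S (fun x => (v x : ℝ)) = avg S fun x => (v x : ℝ) * a x := by
  have := sum_normalized_mul_sum (fun j => (S j).2 * v (S j).1) fun i => a (S i).1
  unfold avg
  simp only [NNReal.coe_mul] at this
  rw [mul_left_comm, this]
  simp only [mul_assoc]

/-- The target of the weighted sample after one step with adjustment weights `v`, proposal `p` and
importance weights `ω`. -/
noncomputable def stepTarget (lam : Measure X) [SFinite lam] (v : X → ℝ≥0) (p ω : X → X → ℝ≥0)
    (μ : Measure X) : Measure X :=
  (∫⁻ x, v x ∂μ)⁻¹ • μ.bind (densityKernel lam fun x x' => v x * p x x' * ω x x')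

/-- If `v` vanished `μ`-almost everywhere, so would the kernel `v p ω`. A nonzero next target thus
guarantees a nonzero normalizing constant. -/
lemma lintegral_ne_zero_of_bind_ne_zero {lam : Measure X} [SFinite lam] {v : X → ℝ≥0}
    {p ω : X → X → ℝ≥0} (hv : Measurable v) (hp : IsTransitionDensity lam p)
    (hω : Measurable (Function.uncurry ω)) {μ : Measure X}
    (hμ : μ.bind (densityKernel lam fun x x' => v x * p x x' * ω x x') ≠ 0) :
    ∫⁻ x, v x ∂μ ≠ 0 := by
  have hpm := hp.measurable
  intro h0
  apply hμ
  rw [lintegral_eq_zero_iff (by fun_prop)] at h0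
  rw [← Measure.measure_univ_eq_zero, ← lintegral_one, lintegral_bind_densityKernel (by fun_prop)
    measurable_const]
  refine (lintegral_congr_ae (g := fun _ => 0) ?_).trans lintegral_zero
  filter_upwards [h0] with x hx
  have : v x = 0 := by simpa using hx
  simp [this]

section Step

variable {lam : Measure X} [SFinite lam] {v : X → ℝ≥0} {p ω : X → X → ℝ≥0}
  (hv : Measurable v) (hp : IsTransitionDensity lam p) (hω : Measurable (Function.uncurry ω))
  {Kv Kω : ℝ≥0} (hKv : ∀ x, v x ≤ Kv) (hKω : ∀ x x', ω x x' ≤ Kω)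

include hv hp hω hKv hKω

lemma isFiniteKernel_step :
    IsFiniteKernel (densityKernel lam fun x x' => v x * p x x' * ω x x') := by
  have hm := hp.measurable
  refine isFiniteKernel_densityKernel (by fun_prop) (K := Kv * Kω) fun x => ?_
  calc ∫⁻ x', ((v x * p x x' * ω x x' : ℝ≥0) : ℝ≥0∞) ∂lam
      ≤ ∫⁻ x', (Kv * Kω : ℝ≥0) * (p x x' : ℝ≥0∞) ∂lam := by
        refine lintegral_mono fun x' => ?_
        rw [← ENNReal.coe_mul, ENNReal.coe_le_coe]
        calc v x * p x x' * ω x x' ≤ Kv * p x x' * Kω := by gcongr; exacts [hKv x, hKω x x']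
          _ = Kv * Kω * p x x' := by ring
    _ = (Kv * Kω : ℝ≥0) := by
        rw [lintegral_const_mul _ (f := fun x' => (p x x' : ℝ≥0∞))
          (hm.comp measurable_prodMk_left).coe_nnreal_ennreal, hp.lintegral_eq_one, mul_one]

lemma integral_stepTarget {μ : Measure X} [IsFiniteMeasure μ] {h : X → ℝ} (hh : Measurable h)
    {M : ℝ} (hM : ∀ x, |h x| ≤ M) :
    ∫ x, h x ∂(stepTarget lam v p ω μ) =
      (∫ x, (v x : ℝ) * ∫ x', ω x x' * h x' ∂(kernelOf lam p x) ∂μ) / ∫ x, (v x : ℝ) ∂μ := by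
  have := isFiniteKernel_step hv hp hω hKv hKω
  have hm := hp.measurable
  rw [stepTarget, integral_smul_measure, integral_bind_kernel hh hM]
  have h1 : (∫⁻ x, v x ∂μ)⁻¹.toReal = (∫ x, (v x : ℝ) ∂μ)⁻¹ := by
    rw [ENNReal.toReal_inv, integral_coe_nnreal hv]
  rw [h1, smul_eq_mul, inv_mul_eq_div]
  congr 1
  refine integral_congr_ae (ae_of_all _ fun x => ?_)
  simp only
  rw [integral_densityKernel (by fun_prop), integral_kernelOf hp, ← integral_const_mul]
  refine integral_congr_ae (ae_of_all _ fun x' => ?_)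
  simp only [NNReal.coe_mul]
  ring

/-- The error splits into the fluctuation around the conditional mean (Hoeffding given `S`) and the
distance of that mean from its limit. The mean is the quotient of the averages of `v φ` and `v`,
with `φ(x) = ∫ ω(x, x') h(x') p(x, x') dx'`, and both averages concentrate by assumption. Each
contribution gets `ε / 2`. -/
lemma concentrates_step {L : ∀ N : ℕ, Measure (WeightedSample X N)} {μ : Measure X}
    (hL : Concentrates L μ)
    (hμ : μ.bind (densityKernel lam fun x x' => v x * p x x' * ω x x') ≠ 0) :
    Concentrates (fun N => (L N).bind (stepLaw lam v p ω)) (stepTarget lam v p ω μ) := by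
  have hμf := hL.isFinite
  have hkf := isFiniteKernel_step hv hp hω hKv hKω
  have hpm := hp.measurable
  have hv0 : ∫⁻ x, v x ∂μ ≠ 0 := lintegral_ne_zero_of_bind_ne_zero hv hp hω hμ
  have hvint : Integrable (fun x => (v x : ℝ)) μ :=
    integrable_of_abs_le (by fun_prop) (M := Kv) fun x => by
      rw [NNReal.abs_eq]; exact_mod_cast hKv x
  have hb' : 0 < ∫ x, (v x : ℝ) ∂μ := by
    rw [integral_coe_nnreal hv]
    refine ENNReal.toReal_pos hv0 ?_
    have := hvint.lintegral_lt_top.ne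
    simpa using this
  set b' := ∫ x, (v x : ℝ) ∂μ with hb'_def
  have hbindm : ∀ N, 1 ≤ N → AEMeasurable (stepLaw lam v p ω (N := N)) (L N) := fun N hN =>
    (measurable_stepLaw hv hp hω hN).aemeasurable
  refine ⟨?_, ?_, ?_, ?_⟩
  · unfold stepTarget
    have := Measure.smul_finite (μ.bind (densityKernel lam fun x x' => v x * p x x' * ω x x'))
      (ENNReal.inv_ne_top.2 hv0)
    exact this
  · intro N hN
    have := hL.isProb N hN
    refine ⟨?_⟩
    rw [Measure.bind_apply MeasurableSet.univ (hbindm N hN)]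
    have := fun S => isProbabilityMeasure_stepLaw (N := N) hp hω v hN S
    simp
  · refine ⟨Kω + 1, by positivity, fun N hN => ?_⟩
    have hset : MeasurableSet {S : WeightedSample X N | ∀ i, (S i).2 ≤ Kω + 1} := by
      rw [Set.ofPred_forall]
      exact MeasurableSet.iInter fun i => measurableSet_le (by fun_prop) measurable_const
    change ((L N).bind (stepLaw lam v p ω)) {S | ∀ i, (S i).2 ≤ Kω + 1}ᶜ = 0
    rw [Measure.bind_apply hset.compl (hbindm N hN)]
    refine (lintegral_congr fun S => ?_).trans lintegral_zero
    rw [← mem_ae_iff]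
    have hatt : Measurable fun d : Fin N × X => ((d.2, ω (S d.1).1 d.2) : X × ℝ≥0) :=
      (measurable_attach hω).comp (measurable_prodMk_left (x := S))
    have := isProbabilityMeasure_instrumental hp v hN S
    have := Measure.isProbabilityMeasure_map (μ := instrumental lam v p S) hatt.aemeasurable
    have h1 : ∀ᵐ y ∂((instrumental lam v p S).map fun d => (d.2, ω (S d.1).1 d.2)),
        y.2 ≤ Kω + 1 := by
      rw [ae_map_iff hatt.aemeasurable (measurableSet_le measurable_snd measurable_const)]
      exact ae_of_all _ fun d => (hKω _ _).trans (by simp)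
    change ∀ᵐ S' ∂(stepLaw lam v p ω S), ∀ i, (S' i).2 ≤ Kω + 1
    rw [Filter.eventually_all]
    exact fun i => (Measure.tendsto_eval_ae_ae (μ := fun _ : Fin N =>
      (instrumental lam v p S).map fun d => (d.2, ω (S d.1).1 d.2)) (i := i)).eventually h1
  · obtain ⟨B, C, hB, hC, hdev⟩ := hL.deviation
    set V : ℝ := Kv + 1
    set W : ℝ := Kω + 1
    have hV : 0 < V := by positivity
    have hW : 0 < W := by positivity
    have hvV : ∀ x, |(v x : ℝ)| ≤ V := fun x => by
      rw [NNReal.abs_eq]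
      exact (NNReal.coe_le_coe.2 (hKv x)).trans (by simp [V])
    -- With this `κ` both thresholds below, divided by the sup norms `V W M` of `v φ` and `V` of
    -- `v`, become `κ (ε / M)`.
    set κ : ℝ := b' / (4 * V * W)
    have hκ : 0 < κ := by positivity
    -- Hoeffding at level `ε / 2` for a function bounded by `W M` gives `c (ε / M)`.
    set c : ℝ := (2 * W)⁻¹
    have hc : 0 < c := by positivity
    refine ⟨2 + (B + B), min (1 / 2 * c ^ 2) (min (C * κ ^ 2) (C * κ ^ 2)), by positivity,
      by positivity, fun N hN ε hε h hh M hM hb => ?_⟩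
    have hprob := hL.isProb N hN
    have hωh : ∀ x x', |(ω x x' : ℝ) * h x'| ≤ W * M := fun x x' => by
      rw [abs_mul, NNReal.abs_eq]
      exact mul_le_mul ((NNReal.coe_le_coe.2 (hKω x x')).trans (by simp [W])) (hb _)
        (abs_nonneg _) hW.le
    set φ : X → ℝ := fun x => ∫ x', ω x x' * h x' ∂(kernelOf lam p x) with hφ
    have hφm : Measurable φ := measurable_integral_kernelOf hp (by fun_prop)
    have hφb : ∀ x, |φ x| ≤ W * M := fun x => abs_integral_kernelOf_le hp (hωh x) x
    rw [integral_stepTarget hv hp hω hKv hKω hh hb]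
    set a' := ∫ x, (v x : ℝ) * φ x ∂μ with ha'
    set E₁ : Set (WeightedSample X N) :=
      {S | b' * (ε / 2) / 2 ≤ |avg S (fun x => (v x : ℝ) * φ x) - a'|} with hE₁
    set E₂ : Set (WeightedSample X N) :=
      {S | b' * (ε / 2) / (2 * (W * M)) ≤ |avg S (fun x => (v x : ℝ)) - b'|} with hE₂
    have hE₁m : MeasurableSet E₁ := measurableSet_le measurable_const
      ((measurable_avg measurable_id (by fun_prop)).sub_const a').norm
    have hE₂m : MeasurableSet E₂ := measurableSet_le measurable_const
      ((measurable_avg measurable_id (by fun_prop)).sub_const b').norm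
    have hE₁L : L N E₁ ≤ tail B C N (κ * (ε / M)) := by
      refine (hdev N hN _ (by positivity) (fun x => (v x : ℝ) * φ x) (by fun_prop) (V * (W * M))
        (by positivity) fun x => ?_).trans (le_of_eq ?_)
      · rw [abs_mul]
        exact mul_le_mul (hvV x) (hφb x) (abs_nonneg _) hV.le
      · congr 1
        simp only [κ]
        field_simp
        norm_num
    have hE₂L : L N E₂ ≤ tail B C N (κ * (ε / M)) := by
      refine (hdev N hN _ (by positivity) (fun x => (v x : ℝ)) (by fun_prop) V
        hV hvV).trans (le_of_eq ?_)
      congr 1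
      simp only [κ]
      field_simp
      norm_num
    have hEm : MeasurableSet {S : WeightedSample X N | ε ≤ |avg S h - a' / b'|} :=
      measurableSet_le measurable_const
        ((measurable_avg measurable_id (by fun_prop)).sub_const _).norm
    -- On the bad event `E₁ ∪ E₂` the conditional probability is bounded by `1`; off it the
    -- conditional mean is within `ε / 2` of the limit.
    have hstep : ∀ S : WeightedSample X N,
        stepLaw lam v p ω S {S' | ε ≤ |avg S' h - a' / b'|} ≤
          tail 2 (1 / 2) N (c * (ε / M)) + (E₁ ∪ E₂).indicator (fun _ => 1) S := by
      intro S
      have hprS := isProbabilityMeasure_stepLaw (N := N) hp hω v hN S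
      by_cases hS : S ∈ E₁ ∪ E₂
      · rw [Set.indicator_of_mem hS]
        exact prob_le_one.trans le_add_self
      rw [Set.indicator_of_notMem hS, add_zero]
      rw [Set.mem_union, not_or] at hS
      have h1 : _ < b' * (ε / 2) / 2 := not_le.1 hS.1
      have h2 : _ < b' * (ε / 2) / (2 * (W * M)) := not_le.1 hS.2
      set m := ∑ i, (normalized (fun j => (S j).2 * v (S j).1) i : ℝ) * φ (S i).1 with hm
      have hmD : |m| ≤ W * M := abs_sum_normalized_le hN _ fun i => hφb _
      have hdiff : |m - a' / b'| < ε / 2 :=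
        abs_sub_div_lt (avg_mul_sum_normalized S v φ) (by positivity) hmD hb' h1 h2
      have hatt : Measurable fun d : Fin N × X => ((d.2, ω (S d.1).1 d.2) : X × ℝ≥0) :=
        (measurable_attach hω).comp (measurable_prodMk_left (x := S))
      have := isProbabilityMeasure_instrumental hp v hN S
      have := Measure.isProbabilityMeasure_map (μ := instrumental lam v p S) hatt.aemeasurable
      have hfm : Measurable fun y : X × ℝ≥0 => (y.2 : ℝ) * h y.1 := by fun_prop
      have hmint : ∫ y, (y.2 : ℝ) * h y.1
          ∂((instrumental lam v p S).map fun d => (d.2, ω (S d.1).1 d.2)) = m := by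
        rw [integral_map hatt.aemeasurable hfm.aestronglyMeasurable, integral_instrumental hp v S
          (f := fun d => (ω (S d.1).1 d.2 : ℝ) * h d.2) (hfm.comp hatt) (fun y => hωh _ _)]
      have hH := hoeffding_pi (ν := (instrumental lam v p S).map fun d => (d.2, ω (S d.1).1 d.2))
        hfm (M := W * M) (by positivity) (by
          rw [ae_map_iff hatt.aemeasurable (measurableSet_le
            (by simpa using hfm.norm) measurable_const)]
          exact ae_of_all _ fun d => hωh _ _) hN (half_pos hε)
      rw [hmint] at hH
      refine (measure_mono ?_).trans (hH.trans (le_of_eq ?_))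
      · intro S' hS'
        simp only [Set.mem_ofPred_eq] at hS' ⊢
        have h3 := abs_sub_le (avg S' h) m (a' / b')
        have h4 : ε / 2 ≤ |avg S' h - m| := by linarith
        exact h4
      · rw [tail]
        congr 4
        simp only [c]
        field_simp
    rw [Measure.bind_apply hEm (hbindm N hN)]
    calc ∫⁻ S, stepLaw lam v p ω S {S' | ε ≤ |avg S' h - a' / b'|} ∂(L N)
        ≤ ∫⁻ S, tail 2 (1 / 2) N (c * (ε / M)) + (E₁ ∪ E₂).indicator (fun _ => 1) S ∂(L N) :=
          lintegral_mono hstep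
      _ = tail 2 (1 / 2) N (c * (ε / M)) + L N (E₁ ∪ E₂) := by
          rw [lintegral_add_left measurable_const, lintegral_const, measure_univ, mul_one,
            lintegral_indicator_const (hE₁m.union hE₂m), one_mul]
      _ ≤ tail 2 (1 / 2) N (c * (ε / M)) +
            (tail B C N (κ * (ε / M)) + tail B C N (κ * (ε / M))) := by
          gcongr
          exact (measure_union_le _ _).trans (add_le_add hE₁L hE₂L)
      _ ≤ _ := by
          simp only [tail_mul]
          refine (add_le_add le_rfl (tail_add_le hB.le hB.le _ _ _ _)).trans
            (tail_add_le (by norm_num) (by positivity) _ _ _ _)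

/-- One step, up to normalization of the targets. -/
lemma concentrates_step_smul {L : ∀ N : ℕ, Measure (WeightedSample X N)} {μ : Measure X}
    {c : ℝ≥0∞} (hc : c ≠ 0) (hL : Concentrates L (c • μ)) {r : X → X → ℝ≥0}
    (hr : ∀ x x', v x * p x x' * ω x x' = r x x') (hμ : μ.bind (densityKernel lam r) ≠ 0) :
    ∃ c' : ℝ≥0∞, c' ≠ 0 ∧ c' ≠ ∞ ∧
      Concentrates (fun N => (L N).bind (stepLaw lam v p ω))
        (c' • μ.bind (densityKernel lam r)) := by
  have hcf := hL.isFinite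
  obtain rfl : (fun x x' => v x * p x x' * ω x x') = r := funext₂ hr
  have hcμ : (c • μ).bind (densityKernel lam fun x x' => v x * p x x' * ω x x') ≠ 0 := by
    rw [Measure.bind_smul]
    intro h0
    apply hμ
    have h1 := congrArg (fun ν : Measure X => ν Set.univ) h0
    simpa [hc] using h1
  have h0 := lintegral_ne_zero_of_bind_ne_zero hv hp hω hcμ
  have htop : ∫⁻ x, v x ∂(c • μ) ≠ ∞ := by
    refine ne_top_of_le_ne_top (b := ∫⁻ _, (Kv : ℝ≥0∞) ∂(c • μ)) ?_
      (lintegral_mono fun x => ENNReal.coe_le_coe.2 (hKv x))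
    rw [lintegral_const]
    exact ENNReal.mul_ne_top ENNReal.coe_ne_top (measure_ne_top _ _)
  -- `c • μ` is finite, and `μ` is nonzero because its image under the kernel is.
  have hctop : c ≠ ∞ := by
    rintro rfl
    have h1 : (∞ • μ) Set.univ ≠ ∞ := measure_ne_top _ _
    apply h1
    have hμ0 : μ ≠ 0 := by
      rintro rfl
      simp at hμ
    simp [hμ0]
  refine ⟨(∫⁻ x, v x ∂(c • μ))⁻¹ * c, ?_, ENNReal.mul_ne_top (ENNReal.inv_ne_top.2 h0) hctop, ?_⟩
  · exact mul_ne_zero (ENNReal.inv_ne_zero.2 htop) hc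
  · have := concentrates_step hv hp hω hKv hKω hL hcμ
    rwa [stepTarget, Measure.bind_smul, smul_smul] at this

end Step

/-! ### Two independent weighted samples -/

section Pair

variable {L L' : ∀ N : ℕ, Measure (WeightedSample X N)} {μ μ' : Measure X}

lemma integral_avg [IsFiniteMeasure μ] {N : ℕ} (S : WeightedSample X N) {F : X → X → ℝ}
    (hF : Measurable (Function.uncurry F)) {M : ℝ} (hM : ∀ x y, |F x y| ≤ M) :
    ∫ x, avg S (F x) ∂μ = avg S fun y => ∫ x, F x y ∂μ := by
  unfold avg
  rw [integral_const_mul, integral_finsetSum]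
  · simp only [integral_const_mul]
  · exact fun i _ => (integrable_of_abs_le (by fun_prop) fun x => hM x _).const_mul _

/-- With the second sample frozen, `x ↦ avg S.2 (F x)` is a bounded test function for the first one;
here the weight bound of the second sample enters. What remains is an average over the second sample
of `y ↦ ∫ F(x, y) μ(dx)`. -/
lemma Concentrates.deviation_prod (hL : Concentrates L μ) (hL' : Concentrates L' μ') :
    ∃ B C : ℝ, 0 < B ∧ 0 < C ∧ ∀ N, 1 ≤ N → ∀ ε : ℝ, 0 < ε → ∀ F : X → X → ℝ,
      Measurable (Function.uncurry F) → ∀ M : ℝ, 0 < M → (∀ x y, |F x y| ≤ M) →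
      ((L N).prod (L' N)) {S | ε ≤ |avg S.1 (fun x => avg S.2 (F x)) -
        ∫ x, ∫ y, F x y ∂μ' ∂μ|} ≤ tail B C N (ε / M) := by
  have hμ := hL.isFinite
  have hμ' := hL'.isFinite
  obtain ⟨B, C, hB, hC, hdev⟩ := hL.deviation
  obtain ⟨B', C', hB', hC', hdev'⟩ := hL'.deviation
  obtain ⟨K, hK, hw⟩ := hL'.weight_le
  set A : ℝ := μ.real Set.univ + 1
  have hA : 0 < A := by positivity
  have hK0 : (0 : ℝ) < K := by exact_mod_cast hK
  -- Each stage gets `ε / 2`; the test functions are bounded by `K M` and `A M` respectively.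
  set κ : ℝ := (2 * K : ℝ)⁻¹
  set κ' : ℝ := (2 * A)⁻¹
  have hκ : 0 < κ := by positivity
  have hκ' : 0 < κ' := by positivity
  refine ⟨B + B', min (C * κ ^ 2) (C' * κ' ^ 2), by positivity, by positivity,
    fun N hN ε hε F hF M hM hb => ?_⟩
  have hp := hL.isProb N hN
  have hp' := hL'.isProb N hN
  set ψ : X → ℝ := fun y => ∫ x, F x y ∂μ with hψ
  have hψm : Measurable ψ := (hF.stronglyMeasurable.integral_prod_left (μ := μ)).measurable
  have hψb : ∀ y, |ψ y| ≤ A * M := fun y =>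
    (abs_integral_le (μ := μ) fun x => hb x y).trans (by gcongr; simp [A])
  have hswap : ∫ x, ∫ y, F x y ∂μ' ∂μ = ∫ y, ψ y ∂μ' :=
    integral_integral_swap (Integrable.of_bound hF.aestronglyMeasurable M
      (ae_of_all _ fun z => hb z.1 z.2))
  rw [hswap]
  set E₁ : Set (WeightedSample X N × WeightedSample X N) :=
    {S | ε / 2 ≤ |avg S.1 (fun x => avg S.2 (F x)) - avg S.2 ψ|} with hE₁
  set E₂ : Set (WeightedSample X N) := {S | ε / 2 ≤ |avg S ψ - ∫ y, ψ y ∂μ'|} with hE₂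
  have hFavg : Measurable (Function.uncurry
      fun (S : WeightedSample X N × WeightedSample X N) (x : X) => avg S.2 (F x)) :=
    measurable_avg (Y := (WeightedSample X N × WeightedSample X N) × X) (S := fun z => z.1.2)
      (by fun_prop) (f := fun z => F z.2)
      (show Measurable (Function.uncurry F ∘
        fun w : ((WeightedSample X N × WeightedSample X N) × X) × X => (w.1.2, w.2)) from
        hF.comp (by fun_prop))
  have hE₁m : MeasurableSet E₁ := measurableSet_le measurable_const
    ((measurable_avg measurable_fst hFavg).sub
      (measurable_avg measurable_snd (f := fun _ => ψ) (hψm.comp measurable_snd))).norm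
  have hE₁L : ((L N).prod (L' N)) E₁ ≤ tail B C N (κ * (ε / M)) := by
    -- Independence: the law of the first sample is integrated inside, for fixed second sample.
    rw [Measure.prod_apply_symm hE₁m]
    calc ∫⁻ S', L N ((fun S => (S, S')) ⁻¹' E₁) ∂(L' N)
        ≤ ∫⁻ _, tail B C N (κ * (ε / M)) ∂(L' N) := by
          refine lintegral_mono_ae ((hw N hN).mono fun S' hS' => ?_)
          have h1 := hdev N hN (ε / 2) (by positivity) (fun x => avg S' (F x))
            (measurable_avg measurable_const hF) (K * M) (by positivity)
            (fun x => abs_avg_le hM.le hS' (hb x))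
          rw [integral_avg S' hF hb] at h1
          refine h1.trans (le_of_eq ?_)
          congr 1
          simp only [κ]
          field_simp
      _ = _ := by rw [lintegral_const, measure_univ, mul_one]
  have hE₂L : ((L N).prod (L' N)) (Set.univ ×ˢ E₂) ≤ tail B' C' N (κ' * (ε / M)) := by
    rw [Measure.prod_prod, measure_univ, one_mul]
    refine (hdev' N hN (ε / 2) (by positivity) ψ hψm (A * M) (by positivity) hψb).trans
      (le_of_eq ?_)
    congr 1
    simp only [κ']
    field_simp
  refine (measure_mono (t := E₁ ∪ Set.univ ×ˢ E₂) ?_).trans ((measure_union_le _ _).trans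
    ((add_le_add hE₁L hE₂L).trans ?_))
  · intro S hS
    simp only [hE₁, hE₂, Set.mem_union, Set.mem_prod, Set.mem_univ, true_and,
      Set.mem_ofPred_eq] at hS ⊢
    by_contra! hcon
    have := abs_sub_le (avg S.1 (fun x => avg S.2 (F x))) (avg S.2 ψ) (∫ y, ψ y ∂μ')
    linarith [hcon.1, hcon.2]
  · simp only [tail_mul]
    exact tail_add_le hB.le hB'.le _ _ _ _

/-- `m` is specified only through `m * b = a` and `|m| ≤ M`, so that both estimators fit, including
samples whose total weight vanishes. -/
lemma Concentrates.deviation_ratio (hL : Concentrates L μ) (hL' : Concentrates L' μ')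
    {k : X → X → ℝ≥0} (hk : Measurable (Function.uncurry k)) {K : ℝ≥0} (hK : ∀ x y, k x y ≤ K)
    (hpos : 0 < ∫ x, ∫ y, (k x y : ℝ) ∂μ' ∂μ) :
    ∃ B C : ℝ, 0 < B ∧ 0 < C ∧ ∀ N, 1 ≤ N → ∀ ε : ℝ, 0 < ε → ∀ F : X → X → ℝ,
      Measurable (Function.uncurry F) → ∀ M : ℝ, 0 < M → (∀ x y, |F x y| ≤ M) →
      ∀ m : WeightedSample X N × WeightedSample X N → ℝ, (∀ S, |m S| ≤ M) →
      (∀ S, m S * avg S.1 (fun x => avg S.2 fun y => (k x y : ℝ)) =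
        avg S.1 fun x => avg S.2 fun y => k x y * F x y) →
      ((L N).prod (L' N)) {S | ε ≤ |m S -
        (∫ x, ∫ y, k x y * F x y ∂μ' ∂μ) / ∫ x, ∫ y, (k x y : ℝ) ∂μ' ∂μ|} ≤
      tail B C N (ε / M) := by
  obtain ⟨B, C, hB, hC, hdev⟩ := hL.deviation_prod hL'
  set V : ℝ := K + 1
  have hV : 0 < V := by positivity
  have hkV : ∀ x y, |(k x y : ℝ)| ≤ V := fun x y => by
    rw [NNReal.abs_eq]
    exact (NNReal.coe_le_coe.2 (hK x y)).trans (by simp [V])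
  set b' := ∫ x, ∫ y, (k x y : ℝ) ∂μ' ∂μ with hb'
  set κ := b' / (2 * V)
  have hκ : 0 < κ := by positivity
  refine ⟨B + B, min (C * κ ^ 2) (C * κ ^ 2), by positivity, by positivity,
    fun N hN ε hε F hF M hM hb m hm hmk => ?_⟩
  set a' := ∫ x, ∫ y, k x y * F x y ∂μ' ∂μ with ha'
  have h1 := hdev N hN (b' * ε / 2) (by positivity) (fun x y => k x y * F x y) (by fun_prop)
    (V * M) (by positivity) fun x y => by
      rw [abs_mul]
      exact mul_le_mul (hkV x y) (hb x y) (abs_nonneg _) hV.le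
  have h2 := hdev N hN (b' * ε / (2 * M)) (by positivity) (fun x y => (k x y : ℝ)) (by fun_prop)
    V hV hkV
  have e1 : b' * ε / 2 / (V * M) = κ * (ε / M) := by simp only [κ]; field_simp
  have e2 : b' * ε / (2 * M) / V = κ * (ε / M) := by simp only [κ]; field_simp
  rw [e1] at h1
  rw [e2] at h2
  refine (measure_mono ?_).trans ((measure_union_le _ _).trans ((add_le_add h1 h2).trans ?_))
  · intro S hS
    simp only [Set.mem_union, Set.mem_ofPred_eq] at hS ⊢
    by_contra! hcon
    exact absurd hS (not_le.2 (abs_sub_div_lt (hmk S) hM (hm S) hpos hcon.1 hcon.2))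
  · simp only [tail_mul]
    exact tail_add_le hB.le hB.le _ _ _ _

end Pair

/-! ### Path integrals -/

section PathIntegral

variable {lam : Measure X} {q : X → X → ℝ≥0}

lemma pathIntegral_congr {f f' : ℕ → X → ℝ} {n t : ℕ} (h : ∀ u, t ≤ u → u ≤ t + n → f u = f' u) :
    pathIntegral lam q f n t = pathIntegral lam q f' n t := by
  induction n generalizing t with
  | zero => exact h t le_rfl le_rfl
  | succ n ih =>
    funext x
    simp only [pathIntegral]
    rw [h t le_rfl (by omega), ih fun u hu hu' => h u (by omega) (by omega)]

/-- Markov property: the path is cut after `n` transitions, and the next transition with the `m`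
that follow it becomes a factor at time `t + n`. -/
lemma pathIntegral_add (f : ℕ → X → ℝ) (n m t : ℕ) (x : X) :
    pathIntegral lam q f (n + m + 1) t x =
      pathIntegral lam q (fun u y => f u y * if u = t + n then
        ∫ x', pathIntegral lam q f m (t + n + 1) x' ∂(kernelOf lam q y) else 1) n t x := by
  induction n generalizing t x with
  | zero => simp [pathIntegral]
  | succ n ih =>
    rw [show n + 1 + m + 1 = (n + m + 1) + 1 by omega, pathIntegral, pathIntegral,
      if_neg (by omega), mul_one]
    simp only [ih, show t + (n + 1) = t + 1 + n by omega]

lemma pathIntegral_indicator_mul (f : ℕ → X → ℝ) (h : X → ℝ) (n t : ℕ) (x : X) :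
    pathIntegral lam q (fun u y => f u y * if u = t then h y else 1) n t x =
      pathIntegral lam q f n t x * h x := by
  cases n with
  | zero => simp [pathIntegral]
  | succ n =>
    simp only [pathIntegral, if_true]
    rw [pathIntegral_congr (f := fun u y => f u y * if u = t then h y else 1) (f' := f) fun u hu _ =>
      by simp [show u ≠ t by omega]]
    ring

lemma measurable_pathIntegral [SFinite lam] (hq : IsTransitionDensity lam q) {f : ℕ → X → ℝ}
    (hf : ∀ u, Measurable (f u)) (n t : ℕ) : Measurable (pathIntegral lam q f n t) := by
  induction n generalizing t with
  | zero => exact hf t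
  | succ n ih =>
    exact (hf t).mul (measurable_integral_kernelOf hq (f := fun _ => pathIntegral lam q f n (t + 1))
      ((ih (t + 1)).comp measurable_snd))

lemma exists_abs_pathIntegral_le (hq : IsTransitionDensity lam q) {f : ℕ → X → ℝ} {n t : ℕ}
    (hf : ∀ u, t ≤ u → u ≤ t + n → ∃ K, ∀ x, |f u x| ≤ K) :
    ∃ K, ∀ x, |pathIntegral lam q f n t x| ≤ K := by
  induction n generalizing t with
  | zero => exact hf t le_rfl le_rfl
  | succ n ih =>
    obtain ⟨K, hK⟩ := hf t le_rfl (by omega)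
    obtain ⟨K', hK'⟩ := ih (t := t + 1) fun u hu hu' => hf u (by omega) (by omega)
    refine ⟨K * K', fun x => ?_⟩
    simp only [pathIntegral, abs_mul]
    exact mul_le_mul (hK x) (abs_integral_kernelOf_le hq hK' x) (abs_nonneg _)
      ((abs_nonneg _).trans (hK x))

lemma integral_pos_of_pos {μ : Measure X} [IsProbabilityMeasure μ] {h : X → ℝ} (hh : Measurable h)
    {K : ℝ} (hK : ∀ x, |h x| ≤ K) (hpos : ∀ x, 0 < h x) : 0 < ∫ x, h x ∂μ := by
  rw [integral_pos_iff_support_of_nonneg (fun x => (hpos x).le) (integrable_of_abs_le hh hK)]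
  rw [Function.support_eq_univ fun x => (hpos x).ne']
  simp

lemma pathIntegral_pos [SFinite lam] (hq : IsTransitionDensity lam q) {f : ℕ → X → ℝ}
    (hfm : ∀ u, Measurable (f u)) {n t : ℕ}
    (hf : ∀ u, t ≤ u → u ≤ t + n → ∃ K, ∀ x, |f u x| ≤ K) (hpos : ∀ u x, 0 < f u x) (x : X) :
    0 < pathIntegral lam q f n t x := by
  induction n generalizing t x with
  | zero => exact hpos t x
  | succ n ih =>
    have hf' : ∀ u, t + 1 ≤ u → u ≤ t + 1 + n → ∃ K, ∀ x, |f u x| ≤ K :=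
      fun u hu hu' => hf u (by omega) (by omega)
    obtain ⟨K, hK⟩ := exists_abs_pathIntegral_le hq hf'
    have := isProbabilityMeasure_kernelOf hq x
    exact mul_pos (hpos t x) (integral_pos_of_pos (measurable_pathIntegral hq hfm n (t + 1)) hK
      fun x' => ih hf' x')

end PathIntegral

/-! ### Smoothing as filter measure times backward function -/

namespace StateSpaceModel

variable {lam : Measure X} {M : StateSpaceModel lam} {T : ℕ}

/-- The backward function `β_t(x) = g_t(x) ∫ Q(x, dx_{t+1}) g_{t+1}(x_{t+1}) ⋯ g_T(x_T)`. -/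
noncomputable def backward (M : StateSpaceModel lam) (T t : ℕ) (x : X) : ℝ :=
  pathIntegral lam M.q (fun u y => (M.g u y : ℝ)) (T - t) t x

lemma exists_abs_g_le (hA : AssumptionA1 M T) {u : ℕ} (hu : u ≤ T) :
    ∃ K : ℝ, ∀ x, |(M.g u x : ℝ)| ≤ K := by
  obtain ⟨K, hK⟩ := hA.g_bdd u hu
  exact ⟨K, fun x => by rw [NNReal.abs_eq]; exact_mod_cast hK x⟩

lemma measurable_backward [SFinite lam] (M : StateSpaceModel lam) (T t : ℕ) :
    Measurable (M.backward T t) :=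
  measurable_pathIntegral M.isTransitionDensity_q (fun u => (M.measurable_g u).coe_nnreal_real) _ _

lemma exists_abs_backward_le (hA : AssumptionA1 M T) {t : ℕ} (ht : t ≤ T) :
    ∃ K : ℝ, ∀ x, |M.backward T t x| ≤ K :=
  exists_abs_pathIntegral_le M.isTransitionDensity_q fun _ _ hu => exists_abs_g_le hA (by omega)

lemma backward_pos [SFinite lam] (hA : AssumptionA1 M T) {t : ℕ} (ht : t ≤ T) (x : X) :
    0 < M.backward T t x :=
  pathIntegral_pos M.isTransitionDensity_q (fun u => (M.measurable_g u).coe_nnreal_real)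
    (fun _ _ hu => exists_abs_g_le hA (by omega)) (fun u x => by exact_mod_cast M.g_pos u x) x

lemma backward_self (x : X) : M.backward T T x = M.g T x := by
  simp [backward, pathIntegral]

lemma backward_eq {t : ℕ} (ht : t < T) (x : X) :
    M.backward T t x = M.g t x * ∫ x', M.backward T (t + 1) x' ∂(kernelOf lam M.q x) := by
  unfold backward
  rw [show T - t = (T - (t + 1)) + 1 by omega]
  rfl

/-- The unnormalized filtering distribution at time `t`. -/
noncomputable def filterMeasure [SFinite lam] (M : StateSpaceModel lam) : ℕ → Measure X
  | 0 => M.χ.withDensity fun x => (M.g 0 x : ℝ≥0∞)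
  | t + 1 => (filterMeasure M t).bind (densityKernel lam fun x x' => M.q x x' * M.g (t + 1) x')

variable [SFinite lam]

lemma isFiniteKernel_filter (hA : AssumptionA1 M T) {t : ℕ} (ht : t ≤ T) :
    IsFiniteKernel (densityKernel lam fun x x' => M.q x x' * M.g t x') := by
  have hq := M.isTransitionDensity_q
  have hqm := hq.measurable
  have hg := M.measurable_g t
  obtain ⟨K, hK⟩ := hA.g_bdd t ht
  refine isFiniteKernel_densityKernel (by fun_prop) (K := K) fun x => ?_
  calc ∫⁻ x', ((M.q x x' * M.g t x' : ℝ≥0) : ℝ≥0∞) ∂lam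
      ≤ ∫⁻ x', (K : ℝ≥0∞) * (M.q x x' : ℝ≥0∞) ∂lam := by
        refine lintegral_mono fun x' => ?_
        rw [← ENNReal.coe_mul, ENNReal.coe_le_coe, mul_comm]
        gcongr
        exact hK x'
    _ = K := by
        rw [lintegral_const_mul _ (f := fun x' => (M.q x x' : ℝ≥0∞))
          (hqm.comp measurable_prodMk_left).coe_nnreal_ennreal, hq.lintegral_eq_one, mul_one]

lemma isFiniteMeasure_filterMeasure (hA : AssumptionA1 M T) {t : ℕ} (ht : t ≤ T) :
    IsFiniteMeasure (M.filterMeasure t) := by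
  have := M.isProb_χ
  induction t with
  | zero =>
    obtain ⟨K, hK⟩ := hA.g_bdd 0 ht
    exact isFiniteMeasure_withDensity_of_le (ae_of_all _ hK)
  | succ t ih =>
    have := ih (by omega)
    have := isFiniteKernel_filter hA ht
    unfold filterMeasure
    infer_instance

/-- The induction runs over all `h`: the last transition is absorbed into the test function `x ↦ ∫
Q(x, dx') g_{t+1}(x') h(x')`. -/
lemma integral_filterMeasure (hA : AssumptionA1 M T) {t : ℕ} (ht : t ≤ T) {h : X → ℝ}
    (hh : Measurable h) {K : ℝ} (hK : ∀ x, |h x| ≤ K) :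
    ∫ x, h x ∂(M.filterMeasure t) = ∫ x, pathIntegral lam M.q
      (fun u y => (M.g u y : ℝ) * if u = t then h y else 1) t 0 x ∂M.χ := by
  have := M.isProb_χ
  have hq := M.isTransitionDensity_q
  have hqm := hq.measurable
  induction t generalizing h K with
  | zero =>
    rw [filterMeasure, integral_withDensity_coe (M.measurable_g 0)]
    simp [pathIntegral]
  | succ t ih =>
    have := isFiniteMeasure_filterMeasure hA (t := t) (by omega)
    have := isFiniteKernel_filter hA ht
    have hg := M.measurable_g (t + 1)
    obtain ⟨Kg, hKg⟩ := exists_abs_g_le hA ht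
    rw [filterMeasure, integral_bind_kernel hh hK]
    have h1 : ∀ x, ∫ x', h x' ∂(densityKernel lam (fun x x' => M.q x x' * M.g (t + 1) x') x) =
        ∫ x', M.g (t + 1) x' * h x' ∂(kernelOf lam M.q x) := by
      intro x
      rw [integral_densityKernel (by fun_prop), integral_kernelOf hq]
      simp only [NNReal.coe_mul, mul_assoc]
    have hb : ∀ x, |(M.g (t + 1) x : ℝ) * h x| ≤ Kg * K := fun x => by
      rw [abs_mul]
      exact mul_le_mul (hKg x) (hK x) (abs_nonneg _) ((abs_nonneg _).trans (hKg x))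
    simp only [h1]
    rw [ih (by omega) (measurable_integral_kernelOf hq (by fun_prop))
      fun x => abs_integral_kernelOf_le hq hb x]
    refine integral_congr_ae (ae_of_all _ fun x => ?_)
    -- Cut just before the last transition, leaving a tail with no further transition.
    have h2 := pathIntegral_add (lam := lam) (q := M.q)
      (fun u y => (M.g u y : ℝ) * if u = t + 1 then h y else 1) t 0 0 x
    simp only [add_zero, zero_add] at h2 ⊢
    rw [h2]
    refine congrFun (pathIntegral_congr fun u _ hu => ?_) x
    funext y
    rw [if_neg (show u ≠ t + 1 by omega), mul_one]
    simp [pathIntegral]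

lemma filterMeasure_ne_zero (hA : AssumptionA1 M T) {t : ℕ} (ht : t ≤ T) :
    M.filterMeasure t ≠ 0 := by
  have := M.isProb_χ
  intro h0
  have h1 := integral_filterMeasure hA ht (h := fun _ => 1) measurable_const (K := 1) (by simp)
  have hm : ∀ u, Measurable fun y => (M.g u y : ℝ) := fun u => (M.measurable_g u).coe_nnreal_real
  have hb : ∀ u, 0 ≤ u → u ≤ 0 + t → ∃ K : ℝ, ∀ x, |(M.g u x : ℝ)| ≤ K :=
    fun u _ hu => exists_abs_g_le hA (by omega)
  obtain ⟨K, hK⟩ := exists_abs_pathIntegral_le M.isTransitionDensity_q hb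
  have h2 := integral_pos_of_pos (μ := M.χ) (measurable_pathIntegral M.isTransitionDensity_q hm t 0)
    hK (pathIntegral_pos M.isTransitionDensity_q hm hb fun u x => by exact_mod_cast M.g_pos u x)
  rw [h0] at h1
  simp only [integral_zero_measure, ite_self, mul_one] at h1
  exact h2.ne h1

/-- The prediction of the backward function: `∫ Q(x, dx') β_{t+1}(x') h(x')`. -/
noncomputable def predict (M : StateSpaceModel lam) (T t : ℕ) (h : X → ℝ) (x : X) : ℝ :=
  ∫ x', M.backward T (t + 1) x' * h x' ∂(kernelOf lam M.q x)

lemma measurable_predict (T t : ℕ) {h : X → ℝ} (hh : Measurable h) :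
    Measurable (M.predict T t h) :=
  measurable_integral_kernelOf M.isTransitionDensity_q
    (f := fun _ x' => M.backward T (t + 1) x' * h x')
    (((M.measurable_backward T (t + 1)).mul hh).comp measurable_snd)

omit [SFinite lam] in
lemma exists_abs_predict_le (hA : AssumptionA1 M T) {t : ℕ} (ht : t < T) {h : X → ℝ} {K : ℝ}
    (hK : ∀ x, |h x| ≤ K) : ∃ K', ∀ x, |M.predict T t h x| ≤ K' := by
  obtain ⟨K', hK'⟩ := exists_abs_backward_le hA (t := t + 1) ht
  refine ⟨K' * K, fun x => abs_integral_kernelOf_le M.isTransitionDensity_q (fun x' => ?_) x⟩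
  rw [abs_mul]
  exact mul_le_mul (hK' x') (hK x') (abs_nonneg _) ((abs_nonneg _).trans (hK' x'))

/-- Splitting the path integral with the functions `a` at time `t` and `b` at time `t + 1`. -/
lemma integral_mul_predict (hA : AssumptionA1 M T) {t : ℕ} (ht : t < T) {a b : X → ℝ}
    (ha : Measurable a) (hb : Measurable b) {Ka Kb : ℝ} (hKa : ∀ x, |a x| ≤ Ka)
    (hKb : ∀ x, |b x| ≤ Kb) :
    ∫ x, a x * M.predict T t b x ∂(M.filterMeasure t) = ∫ x, pathIntegral lam M.q
      (fun u y => (M.g u y : ℝ) * if u = t then a y else if u = t + 1 then b y else 1) T 0 x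
        ∂M.χ := by
  obtain ⟨K, hK⟩ := exists_abs_predict_le hA ht hKb
  rw [integral_filterMeasure hA ht.le (h := fun x => a x * M.predict T t b x)
    (ha.mul (measurable_predict T t hb)) (K := Ka * K) fun x => by
    rw [abs_mul]
    exact mul_le_mul (hKa x) (hK x) (abs_nonneg _) ((abs_nonneg _).trans (hKa x))]
  refine integral_congr_ae (ae_of_all _ fun x => ?_)
  obtain ⟨m, rfl⟩ : ∃ m, T = t + m + 1 := ⟨T - t - 1, by omega⟩
  rw [pathIntegral_add]
  refine congrFun (pathIntegral_congr fun u _ hu => ?_) x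
  funext y
  simp only [zero_add] at hu ⊢
  rw [if_neg (show u ≠ t + 1 by omega)]
  by_cases hut : u = t
  · subst hut
    simp only [if_true, predict, backward]
    rw [mul_assoc]
    congr 3
    funext x'
    rw [← pathIntegral_indicator_mul, show u + m + 1 - (u + 1) = m by omega]
    refine congrFun (pathIntegral_congr fun v hv _ => ?_) x'
    simp only [if_neg (show v ≠ u by omega)]
  · simp [hut]

/-- This is the limiting denominator of both estimators, up to a constant; positivity of the `g_t`
makes it strictly positive. -/
lemma integral_predict_pos (hA : AssumptionA1 M T) {t : ℕ} (ht : t < T) :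
    0 < ∫ x, M.predict T t (fun _ => 1) x ∂(M.filterMeasure t) := by
  have := M.isProb_χ
  have := isFiniteMeasure_filterMeasure hA ht.le
  obtain ⟨K, hK⟩ := exists_abs_predict_le hA ht (h := fun _ => 1) (K := 1) (by simp)
  obtain ⟨K', hK'⟩ := exists_abs_backward_le hA (t := t + 1) ht
  have hpos : ∀ x, 0 < M.predict T t (fun _ => 1) x := fun x => by
    have := isProbabilityMeasure_kernelOf M.isTransitionDensity_q x
    simp only [predict, mul_one]
    exact integral_pos_of_pos (M.measurable_backward T (t + 1)) hK' (backward_pos hA ht)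
  rw [integral_pos_iff_support_of_nonneg (fun x => (hpos x).le)
    (integrable_of_abs_le (measurable_predict T t measurable_const) hK),
    Function.support_eq_univ fun x => (hpos x).ne']
  simpa [pos_iff_ne_zero] using filterMeasure_ne_zero hA ht.le

/-- Here `h` sits at time `t`; in `smoothing_eq_backward` it sits at time `t + 1`, with the same
denominator. One deviation inequality for products `a(x) b(x')` therefore serves both estimators. -/
lemma smoothing_eq_forward (hA : AssumptionA1 M T) {t : ℕ} (ht : t < T) {h : X → ℝ}
    (hh : Measurable h) {K : ℝ} (hK : ∀ x, |h x| ≤ K) :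
    M.smoothing T t h = (∫ x, h x * M.predict T t (fun _ => 1) x ∂(M.filterMeasure t)) /
      ∫ x, M.predict T t (fun _ => 1) x ∂(M.filterMeasure t) := by
  have h1 := integral_mul_predict hA ht hh (b := fun _ => 1) measurable_const hK (Kb := 1) (by simp)
  have h2 := integral_mul_predict hA ht (a := fun _ => 1) (b := fun _ => 1) measurable_const
    measurable_const (Ka := 1) (Kb := 1) (by simp) (by simp)
  simp only [ite_self, one_mul, mul_one] at h1 h2
  rw [h1, h2, smoothing]

lemma smoothing_eq_backward (hA : AssumptionA1 M T) {t : ℕ} (ht : t < T) {h : X → ℝ}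
    (hh : Measurable h) {K : ℝ} (hK : ∀ x, |h x| ≤ K) :
    M.smoothing T (t + 1) h = (∫ x, M.predict T t h x ∂(M.filterMeasure t)) /
      ∫ x, M.predict T t (fun _ => 1) x ∂(M.filterMeasure t) := by
  have h1 := integral_mul_predict hA ht (a := fun _ => 1) measurable_const hh (Ka := 1) (by simp) hK
  have h2 := integral_mul_predict hA ht (a := fun _ => 1) (b := fun _ => 1) measurable_const
    measurable_const (Ka := 1) (Kb := 1) (by simp) (by simp)
  simp only [ite_self, one_mul, mul_one] at h1 h2
  rw [h1, h2, smoothing]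
  congr 2
  funext x
  refine congrFun (pathIntegral_congr fun u _ _ => ?_) x
  by_cases hu : u = t
  · simp [hu]
  · simp [hu]

lemma smoothing_sub_const (hA : AssumptionA1 M T) {t : ℕ} (ht : t < T) {h : X → ℝ}
    (hh : Measurable h) {K : ℝ} (hK : ∀ x, |h x| ≤ K) (c : ℝ) :
    M.smoothing T t (fun x => h x - c) = M.smoothing T t h - c := by
  have := isFiniteMeasure_filterMeasure hA ht.le
  have hpos := integral_predict_pos hA ht
  have hm := measurable_predict (M := M) T t (h := fun _ => 1) measurable_const
  obtain ⟨K', hK'⟩ := exists_abs_predict_le hA ht (h := fun _ => 1) (K := 1) (by simp)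
  have hK0 : ∀ x, |h x * M.predict T t (fun _ => 1) x| ≤ K * K' := fun x => by
    rw [abs_mul]
    exact mul_le_mul (hK x) (hK' x) (abs_nonneg _) ((abs_nonneg _).trans (hK x))
  rw [smoothing_eq_forward hA ht hh hK, smoothing_eq_forward hA ht (hh.sub_const c) (K := K + |c|)
    fun x => (abs_sub _ _).trans (by gcongr; exact hK x)]
  simp only [sub_mul]
  rw [integral_sub (f := fun x => h x * M.predict T t (fun _ => 1) x)
    (integrable_of_abs_le (hh.mul hm) hK0)
    ((integrable_of_abs_le hm hK').const_mul c), integral_const_mul, sub_div,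
    mul_div_assoc, div_self hpos.ne', mul_one]

end StateSpaceModel

section Filters

variable {lam : Measure X} {M : StateSpaceModel lam} {T : ℕ}

/-! ### The forward filter -/

/-- Boundedness of `a / b` in the form `a ≤ K * b` forces `a = 0` wherever `b = 0`, so importance
weights lose nothing at zeros of the proposal. -/
lemma mul_div_cancel_of_le {a b K : ℝ≥0} (h : a ≤ K * b) : b * (a / b) = a := by
  rcases eq_or_ne b 0 with rfl | hb
  · have ha : a = 0 := by simpa using h
    simp [ha]
  · exact mul_div_cancel₀ a hb

lemma ForwardFilter.measurable_weightInit (F : ForwardFilter M) : Measurable F.weightInit :=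
  (Measure.measurable_rnDeriv _ _).ennreal_toNNReal.mul (M.measurable_g 0)

lemma ForwardFilter.measurable_weight (F : ForwardFilter M) (t : ℕ) :
    Measurable (Function.uncurry (F.weight t)) := by
  have h1 := M.isTransitionDensity_q.measurable
  have h2 := M.measurable_g t
  have h3 := F.measurable_ϑ t
  have h4 := (F.isTransitionDensity_p t).measurable
  unfold ForwardFilter.weight
  fun_prop

lemma ForwardFilter.withDensity_weightInit (F : ForwardFilter M) :
    F.ρ.withDensity (fun x => (F.weightInit x : ℝ≥0∞)) = M.χ.withDensity fun x => (M.g 0 x : ℝ≥0∞) := by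
  have := F.isProb_ρ
  have := M.isProb_χ
  have hg := (M.measurable_g 0).coe_nnreal_ennreal
  have hr : Measurable (M.χ.rnDeriv F.ρ) := Measure.measurable_rnDeriv _ _
  -- Absolute continuity lets `χ` be recovered from its density; `toNNReal` is harmless because that
  -- density is finite almost everywhere.
  conv_rhs => rw [← Measure.withDensity_rnDeriv_eq M.χ F.ρ F.χ_ac, ← withDensity_mul _ hr hg]
  refine withDensity_congr_ae ((Measure.rnDeriv_lt_top M.χ F.ρ).mono fun x hx => ?_)
  simp [ForwardFilter.weightInit, ENNReal.coe_toNNReal hx.ne]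

/-- `ϑ p ω = q g` pointwise, so the target depends on the design parameters only through the
constant. -/
lemma ForwardFilter.concentrates_law [SFinite lam] (F : ForwardFilter M) (hA1 : AssumptionA1 M T)
    (hA2 : AssumptionA2 F T) {t : ℕ} (ht : t ≤ T) :
    ∃ c : ℝ≥0∞, c ≠ 0 ∧ c ≠ ∞ ∧ Concentrates (fun N => F.law N t) (c • M.filterMeasure t) := by
  induction t with
  | zero =>
    have := F.isProb_ρ
    obtain ⟨K, hK⟩ := hA2.weightInit_bdd
    have := concentrates_initialLaw F.measurable_weightInit hK
    rw [F.withDensity_weightInit] at this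
    exact ⟨1, one_ne_zero, ENNReal.one_ne_top, by rw [one_smul]; exact this⟩
  | succ t ih =>
    obtain ⟨c, hc, -, hL⟩ := ih (by omega)
    obtain ⟨Kv, hKv⟩ := hA2.ϑ_bdd (t + 1) (by omega) ht
    obtain ⟨Kω, hKω⟩ := hA2.weight_bdd (t + 1) (by omega) ht
    refine concentrates_step_smul (F.measurable_ϑ (t + 1)) (F.isTransitionDensity_p (t + 1))
      (F.measurable_weight (t + 1)) hKv (Kω := Kω)
      (fun x x' => NNReal.div_le_of_le_mul (hKω x x')) hc hL
      (fun x x' => mul_div_cancel_of_le (hKω x x')) (StateSpaceModel.filterMeasure_ne_zero hA1 ht)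

/-! ### The backward information filter -/

/-- The unnormalized target `γ_t(x) β_t(x) lam(dx)` of the backward information filter. -/
noncomputable def BackwardFilter.target (G : BackwardFilter M T) (t : ℕ) : Measure X :=
  lam.withDensity fun x => ((G.γ t x * (M.backward T t x).toNNReal : ℝ≥0) : ℝ≥0∞)

lemma BackwardFilter.measurable_weightInit (G : BackwardFilter M T) : Measurable G.weightInit :=
  ((M.measurable_g T).mul (G.measurable_γ T)).div G.measurable_ρ

lemma BackwardFilter.measurable_weight (G : BackwardFilter M T) (t : ℕ) :
    Measurable (Function.uncurry (G.weight t)) := by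
  have h1 : Measurable fun z : X × X => M.q z.2 z.1 :=
    M.isTransitionDensity_q.measurable.comp measurable_swap
  have h2 := M.measurable_g t
  have h3 := G.measurable_ϑ t
  have h4 := (G.isTransitionDensity_p t).measurable
  have h5 := G.measurable_γ t
  exact (((h5.comp measurable_snd).mul (h2.comp measurable_snd)).mul h1).div
    ((h3.comp measurable_fst).mul h4)

lemma BackwardFilter.withDensity_weightInit (G : BackwardFilter M T) (hA3 : AssumptionA3 G) :
    (lam.withDensity fun x => (G.ρ x : ℝ≥0∞)).withDensity (fun x => (G.weightInit x : ℝ≥0∞)) =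
      G.target T := by
  obtain ⟨K, hK⟩ := hA3.weightInit_bdd
  rw [← withDensity_mul _ G.measurable_ρ.coe_nnreal_ennreal
    G.measurable_weightInit.coe_nnreal_ennreal, BackwardFilter.target]
  congr 1
  funext x
  simp only [Pi.mul_apply, ← ENNReal.coe_mul]
  rw [BackwardFilter.weightInit, mul_div_cancel_of_le (hK x), StateSpaceModel.backward_self,
    Real.toNNReal_coe, mul_comm]

lemma coe_backward [SFinite lam] (hA1 : AssumptionA1 M T) {t : ℕ} (ht : t < T) (x : X) :
    ((M.backward T t x).toNNReal : ℝ≥0∞) =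
      M.g t x * ∫⁻ x', M.q x x' * (M.backward T (t + 1) x').toNNReal ∂lam := by
  have hq := M.isTransitionDensity_q
  have := isProbabilityMeasure_kernelOf hq x
  obtain ⟨K, hK⟩ := StateSpaceModel.exists_abs_backward_le hA1 (t := t + 1) ht
  have hm := M.measurable_backward T (t + 1)
  change ENNReal.ofReal _ = M.g t x * ∫⁻ x', M.q x x' * ENNReal.ofReal _ ∂lam
  rw [StateSpaceModel.backward_eq ht, ENNReal.ofReal_mul NNReal.zero_le_coe,
    ENNReal.ofReal_coe_nnreal, ofReal_integral_eq_lintegral_ofReal (integrable_of_abs_le hm hK)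
      (ae_of_all _ fun x' => (StateSpaceModel.backward_pos hA1 ht x').le), kernelOf,
    lintegral_withDensity_eq_lintegral_mul _ (f := fun x' => (M.q x x' : ℝ≥0∞))
      (hq.measurable.comp measurable_prodMk_left).coe_nnreal_ennreal hm.ennreal_ofReal]
  rfl

lemma coe_mul_div_mul {c : ℝ≥0} (hc : c ≠ 0) (b a g q : ℝ≥0) (f : ℝ≥0∞) :
    ((c * b : ℝ≥0) : ℝ≥0∞) * (((a * g * q / c : ℝ≥0) : ℝ≥0∞) * f) = a * g * f * (q * b) := by
  rw [← mul_assoc, ← ENNReal.coe_mul,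
    show c * b * (a * g * q / c) = a * g * (q * b) by field_simp]
  push_cast
  ring

/-- `γ_{t+1}` cancels between target and kernel. Tonelli then moves the integral over `x'` inside,
where the backward recursion produces `β_t`. With nonnegative integrals no integrability is needed.
-/
lemma BackwardFilter.target_eq_bind [SFinite lam] (G : BackwardFilter M T)
    (hA1 : AssumptionA1 M T) {t : ℕ} (ht : t < T) :
    (G.target (t + 1)).bind (densityKernel lam fun x' x =>
      G.γ t x * M.g t x * M.q x x' / G.γ (t + 1) x') = G.target t := by
  have hγ := G.measurable_γ t
  have hγ' := G.measurable_γ (t + 1)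
  have hg := M.measurable_g t
  have hq : Measurable fun z : X × X => M.q z.2 z.1 :=
    M.isTransitionDensity_q.measurable.comp measurable_swap
  have hq' := M.isTransitionDensity_q.measurable
  have hβ : Measurable fun x => (M.backward T (t + 1) x).toNNReal :=
    (M.measurable_backward T (t + 1)).real_toNNReal
  have hβ0 : Measurable fun x => (M.backward T t x).toNNReal :=
    (M.measurable_backward T t).real_toNNReal
  have hr : Measurable (Function.uncurry fun x' x =>
      G.γ t x * M.g t x * M.q x x' / G.γ (t + 1) x') :=
    (((hγ.comp measurable_snd).mul (hg.comp measurable_snd)).mul hq).div (hγ'.comp measurable_fst)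
  refine Measure.ext_of_lintegral _ fun f hf => ?_
  have hin : Measurable fun z : X × X =>
      ((G.γ t z.2 * M.g t z.2 * M.q z.2 z.1 / G.γ (t + 1) z.1 : ℝ≥0) : ℝ≥0∞) * f z.2 :=
    hr.coe_nnreal_ennreal.mul (hf.comp measurable_snd)
  rw [lintegral_bind_densityKernel hr hf, target, target,
    lintegral_withDensity_eq_lintegral_mul _ (by fun_prop) hin.lintegral_prod_right',
    lintegral_withDensity_eq_lintegral_mul _ (by fun_prop) hf]
  simp only [Pi.mul_apply]
  calc ∫⁻ x', ((G.γ (t + 1) x' * (M.backward T (t + 1) x').toNNReal : ℝ≥0) : ℝ≥0∞) *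
        ∫⁻ x, ((G.γ t x * M.g t x * M.q x x' / G.γ (t + 1) x' : ℝ≥0) : ℝ≥0∞) * f x ∂lam ∂lam
      = ∫⁻ x', ∫⁻ x, (G.γ t x * M.g t x * f x) *
          (M.q x x' * (M.backward T (t + 1) x').toNNReal) ∂lam ∂lam := by
        refine lintegral_congr fun x' => ?_
        rw [← lintegral_const_mul _ (f := fun x =>
          ((G.γ t x * M.g t x * M.q x x' / G.γ (t + 1) x' : ℝ≥0) : ℝ≥0∞) * f x)
          (by fun_prop)]
        exact lintegral_congr fun x => coe_mul_div_mul (G.γ_pos (t + 1) x').ne' _ _ _ _ _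
    _ = ∫⁻ x, ∫⁻ x', (G.γ t x * M.g t x * f x) *
          (M.q x x' * (M.backward T (t + 1) x').toNNReal) ∂lam ∂lam :=
        lintegral_lintegral_swap ((((hγ.comp measurable_snd).coe_nnreal_ennreal.mul
          (hg.comp measurable_snd).coe_nnreal_ennreal).mul (hf.comp measurable_snd)).mul
          (hq.coe_nnreal_ennreal.mul (hβ.comp measurable_fst).coe_nnreal_ennreal)).aemeasurable
    _ = ∫⁻ x, ((G.γ t x * (M.backward T t x).toNNReal : ℝ≥0) : ℝ≥0∞) * f x ∂lam := by
        refine lintegral_congr fun x => ?_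
        rw [lintegral_const_mul _ (by fun_prop), ENNReal.coe_mul, coe_backward hA1 ht]
        ring

lemma StateSpaceModel.lam_ne_zero (M : StateSpaceModel lam) : lam ≠ 0 := by
  have := M.isProb_χ
  obtain ⟨x⟩ := nonempty_of_isProbabilityMeasure M.χ
  rintro rfl
  simpa using M.isTransitionDensity_q.lintegral_eq_one x

/-- The density `γ_t β_t` is positive everywhere and `lam` is nonzero. -/
lemma BackwardFilter.target_ne_zero [SFinite lam] (G : BackwardFilter M T)
    (hA1 : AssumptionA1 M T) {t : ℕ} (ht : t ≤ T) : G.target t ≠ 0 := by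
  have hγ := G.measurable_γ t
  have hβ : Measurable fun x => (M.backward T t x).toNNReal :=
    (M.measurable_backward T t).real_toNNReal
  rw [target, Ne, withDensity_eq_zero_iff (by fun_prop)]
  intro h0
  apply M.lam_ne_zero
  have hne : ∀ x, ((G.γ t x * (M.backward T t x).toNNReal : ℝ≥0) : ℝ≥0∞) ≠ 0 := fun x => by
    rw [ENNReal.coe_ne_zero]
    exact mul_ne_zero (G.γ_pos t x).ne'
      (Real.toNNReal_pos.2 (StateSpaceModel.backward_pos hA1 ht x)).ne'
  rw [← ae_eq_bot, ← Filter.eventually_false_iff_eq_bot]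
  exact h0.mono fun x hx => hne x hx

lemma BackwardFilter.concentrates_lawAux [SFinite lam] (G : BackwardFilter M T)
    (hA1 : AssumptionA1 M T) (hA3 : AssumptionA3 G) {n : ℕ} (hn : n ≤ T) :
    ∃ c : ℝ≥0∞, c ≠ 0 ∧ c ≠ ∞ ∧ Concentrates (fun N => G.lawAux N n) (c • G.target (T - n)) := by
  induction n with
  | zero =>
    have : IsProbabilityMeasure (lam.withDensity fun x => (G.ρ x : ℝ≥0∞)) :=
      ⟨by rw [withDensity_apply _ MeasurableSet.univ, Measure.restrict_univ, G.lintegral_ρ]⟩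
    obtain ⟨K, hK⟩ := hA3.weightInit_bdd
    have := concentrates_initialLaw (ρ := lam.withDensity fun x => (G.ρ x : ℝ≥0∞))
      G.measurable_weightInit (K := K) (ae_of_all _ fun x => NNReal.div_le_of_le_mul (hK x))
    rw [G.withDensity_weightInit hA3] at this
    exact ⟨1, one_ne_zero, ENNReal.one_ne_top, by rw [one_smul]; exact this⟩
  | succ n ih =>
    obtain ⟨c, hc, -, hL⟩ := ih (by omega)
    have ht : T - (n + 1) < T := by omega
    -- Truncated subtraction is exact here since `n + 1 ≤ T`.
    rw [show T - n = T - (n + 1) + 1 by omega] at hL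
    obtain ⟨Kv, hKv⟩ := hA3.ϑ_bdd _ ht
    obtain ⟨Kω, hKω⟩ := hA3.weight_bdd _ ht
    have hbind := G.target_eq_bind hA1 ht
    rw [← hbind]
    refine concentrates_step_smul ((G.measurable_ϑ _).div (G.measurable_γ _))
      (G.isTransitionDensity_p _) (G.measurable_weight _) hKv (Kω := Kω)
      (fun x' x => NNReal.div_le_of_le_mul (hKω x x')) hc hL (fun x' x => ?_)
      (by rw [hbind]; exact G.target_ne_zero hA1 ht.le)
    rw [Pi.div_apply, BackwardFilter.weight, div_mul_eq_mul_div, div_mul_eq_mul_div,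
      mul_div_cancel_of_le (hKω x x')]

lemma BackwardFilter.concentrates_law [SFinite lam] (G : BackwardFilter M T)
    (hA1 : AssumptionA1 M T) (hA3 : AssumptionA3 G) {t : ℕ} (ht : t ≤ T) :
    ∃ c : ℝ≥0∞, c ≠ 0 ∧ c ≠ ∞ ∧ Concentrates (fun N => G.law N t) (c • G.target t) := by
  have := G.concentrates_lawAux hA1 hA3 (n := T - t) (by omega)
  rwa [show T - (T - t) = t by omega] at this

/-! ### The two-filter estimators -/

lemma integral_target [SFinite lam] (G : BackwardFilter M T) (hA1 : AssumptionA1 M T) {t : ℕ}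
    (ht : t < T) (h : X → ℝ) (x : X) :
    ∫ y, ((M.q x y / G.γ (t + 1) y : ℝ≥0) : ℝ) * h y ∂(G.target (t + 1)) = M.predict T t h x := by
  have hγ := G.measurable_γ (t + 1)
  have hβ : Measurable fun x => (M.backward T (t + 1) x).toNNReal :=
    (M.measurable_backward T (t + 1)).real_toNNReal
  rw [BackwardFilter.target, integral_withDensity_coe (by fun_prop), StateSpaceModel.predict,
    integral_kernelOf M.isTransitionDensity_q]
  refine integral_congr_ae (ae_of_all _ fun y => ?_)
  have h0 : (G.γ (t + 1) y : ℝ) ≠ 0 := by exact_mod_cast (G.γ_pos (t + 1) y).ne'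
  simp only [NNReal.coe_mul, NNReal.coe_div,
    Real.coe_toNNReal _ (StateSpaceModel.backward_pos hA1 ht y).le]
  field_simp

/-- The unknown constants of the two filters appear as the common factor `c c'`, independent of `a`
and `b`, which cancels in the quotient. -/
lemma integral_integral_target [SFinite lam] (G : BackwardFilter M T) (hA1 : AssumptionA1 M T)
    {t : ℕ} (ht : t < T) (c c' : ℝ≥0∞) (a b : X → ℝ) :
    ∫ x, ∫ y, ((M.q x y / G.γ (t + 1) y : ℝ≥0) : ℝ) * (a x * b y) ∂(c' • G.target (t + 1))
      ∂(c • M.filterMeasure t) =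
      c.toReal * c'.toReal * ∫ x, a x * M.predict T t b x ∂(M.filterMeasure t) := by
  rw [integral_smul_measure, smul_eq_mul, mul_assoc, ← integral_const_mul c'.toReal]
  congr 2
  funext x
  rw [integral_smul_measure, smul_eq_mul, ← integral_target G hA1 ht, ← integral_const_mul (a x)]
  congr 2
  funext y
  ring

/-- The two-filter estimators of integrals `∫ a(x) b(x')` of a product with respect to the joint
smoothing distribution at times `t` and `t + 1`. -/
lemma deviation_twoFilter [SFinite lam] (F : ForwardFilter M) (G : BackwardFilter M T)
    (hA1 : AssumptionA1 M T) (hA2 : AssumptionA2 F T) (hA3 : AssumptionA3 G) {t : ℕ} (ht : t < T)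
    {K : ℝ≥0} (hK : ∀ x x', M.q x x' / G.γ (t + 1) x' ≤ K) :
    ∃ B C : ℝ, 0 < B ∧ 0 < C ∧ ∀ N, 1 ≤ N → ∀ ε : ℝ, 0 < ε → ∀ a b : X → ℝ, Measurable a →
      Measurable b → ∀ R : ℝ, 0 < R → (∀ x y, |a x * b y| ≤ R) →
      ∀ m : WeightedSample X N × WeightedSample X N → ℝ, (∀ S, |m S| ≤ R) →
      (∀ S, m S * avg S.1 (fun x => avg S.2 fun y => ((M.q x y / G.γ (t + 1) y : ℝ≥0) : ℝ)) =
        avg S.1 fun x => avg S.2 fun y => ((M.q x y / G.γ (t + 1) y : ℝ≥0) : ℝ) * (a x * b y)) →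
      ((F.law N t).prod (G.law N (t + 1))) {S | ε ≤ |m S -
        (∫ x, a x * M.predict T t b x ∂(M.filterMeasure t)) /
          ∫ x, M.predict T t (fun _ => 1) x ∂(M.filterMeasure t)|} ≤ tail B C N (ε / R) := by
  obtain ⟨c, hc, hc', hL⟩ := F.concentrates_law hA1 hA2 ht.le
  obtain ⟨d, hd, hd', hL'⟩ := G.concentrates_law hA1 hA3 (t := t + 1) ht
  have hq := M.isTransitionDensity_q.measurable
  have hγ := G.measurable_γ (t + 1)
  have hc0 : 0 < c.toReal := ENNReal.toReal_pos hc hc'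
  have hd0 : 0 < d.toReal := ENNReal.toReal_pos hd hd'
  have hpos := StateSpaceModel.integral_predict_pos hA1 ht
  have hk1 := integral_integral_target G hA1 ht c d (fun _ => 1) (fun _ => 1)
  simp only [mul_one, one_mul] at hk1
  obtain ⟨B, C, hB, hC, hdev⟩ := hL.deviation_ratio hL'
    (k := fun x y => M.q x y / G.γ (t + 1) y) (by fun_prop) hK (by rw [hk1]; positivity)
  refine ⟨B, C, hB, hC, fun N hN ε hε a b ha hb R hR hab m hm hmk => ?_⟩
  have := hdev N hN ε hε (fun x y => a x * b y) (by fun_prop) R hR hab m hm hmk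
  rwa [integral_integral_target G hA1 ht c d a b, hk1,
    mul_div_mul_left _ _ (mul_pos hc0 hd0).ne'] at this

end Filters

/-! ### Oscillation -/

lemma estimate_sub_const {X : Type*} {N : ℕ} (hN : 1 ≤ N) (w : Fin N → ℝ≥0) (ξ : Fin N → X)
    (h : X → ℝ) (c : ℝ) : estimate w ξ (fun x => h x - c) = estimate w ξ h - c := by
  have h1 : ∑ i, (normalized w i : ℝ) = 1 := by exact_mod_cast sum_normalized hN w
  simp only [estimate, mul_sub, Finset.sum_sub_distrib, ← Finset.sum_mul, h1, one_mul]

lemma abs_estimate_le {X : Type*} {N : ℕ} (hN : 1 ≤ N) (w : Fin N → ℝ≥0) (ξ : Fin N → X)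
    {h : X → ℝ} {R : ℝ} (hR : ∀ x, |h x| ≤ R) : |estimate w ξ h| ≤ R :=
  abs_sum_normalized_le hN w fun _ => hR _

lemma abs_sub_le_osc {X : Type*} {h : X → ℝ} {K : ℝ} (hK : ∀ x, |h x| ≤ K) (x y : X) :
    |h x - h y| ≤ osc h := by
  refine le_ciSup (f := fun z : X × X => |h z.1 - h z.2|) ⟨K + K, ?_⟩ (x, y)
  rintro _ ⟨z, rfl⟩
  exact (abs_sub _ _).trans (add_le_add (hK _) (hK _))

/-- A deviation inequality with the supremum norm implies one with the oscillation. -/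
lemma measure_le_hoeffdingBound [Nonempty X] {Ω : Type*} [MeasurableSpace Ω] {P : Measure Ω} {N : ℕ}
    (hN : 1 ≤ N) {w : Ω → Fin N → ℝ≥0} {ξ : Ω → Fin N → X} {φ : (X → ℝ) → ℝ}
    (hφ : ∀ (h : X → ℝ), Measurable h → (∃ K, ∀ x, |h x| ≤ K) → ∀ c,
      φ (fun x => h x - c) = φ h - c)
    {B B' C C' : ℝ} (hB : 0 < B) (hBB : B ≤ B') (hCC : C' ≤ C) (h0 : φ (fun _ => 0) = 0)
    (hdev : ∀ ε : ℝ, 0 < ε → ∀ h : X → ℝ, Measurable h → ∀ R : ℝ, 0 < R → (∀ x, |h x| ≤ R) →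
      P {S | ε ≤ |estimate (w S) (ξ S) h - φ h|} ≤ tail B C N (ε / R))
    {ε : ℝ} (hε : 0 < ε) {h : X → ℝ} (hh : Measurable h) (hb : ∃ K, ∀ x, |h x| ≤ K) :
    P {S | ε < |estimate (w S) (ξ S) h - φ h|} ≤ ENNReal.ofReal (hoeffdingBound B' C' N ε h) := by
  obtain ⟨x₀⟩ := ‹Nonempty X›
  obtain ⟨K, hK⟩ := hb
  -- Subtracting `h x₀` shifts estimator and limit equally and leaves a function with sup norm at
  -- most `osc h`.
  have hosc : ∀ x, |h x - h x₀| ≤ osc h := fun x => abs_sub_le_osc hK x x₀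
  have hosc0 : 0 ≤ osc h := (abs_nonneg _).trans (hosc x₀)
  have hcenter : ∀ S, estimate (w S) (ξ S) h - φ h =
      estimate (w S) (ξ S) (fun x => h x - h x₀) - φ fun x => h x - h x₀ := fun S => by
    rw [estimate_sub_const hN, hφ h hh ⟨K, hK⟩]
    ring
  simp only [hcenter]
  unfold hoeffdingBound
  split_ifs with h1
  -- For constant `h` the error is identically zero, so the event is empty.
  · have hz : (fun x => h x - h x₀) = fun _ => 0 :=
      funext fun x => abs_nonpos_iff.1 ((hosc x).trans h1.le)
    have he : ∀ S, estimate (w S) (ξ S) (fun _ => 0) = 0 := fun S => by simp [estimate]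
    simp [hz, h0, he, not_lt.2 hε.le]
  · have hpos : 0 < osc h := lt_of_le_of_ne hosc0 (Ne.symm h1)
    refine (measure_mono ?_).trans ((hdev ε hε _ (hh.sub_const _) (osc h) hpos hosc).trans ?_)
    · intro S hS
      simp only [Set.mem_ofPred_eq] at hS ⊢
      exact hS.le
    unfold tail
    refine ENNReal.ofReal_le_ofReal ?_
    rw [mul_div_assoc, ← div_pow]
    have : 0 ≤ B' := hB.le.trans hBB
    gcongr

/-! ### The estimators as quotients of double averages -/

section Estimators

variable {lam : Measure X} {M : StateSpaceModel lam} {T : ℕ}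

/-- The normalizing sum of the weights is `N²` times the double average of `q / γ`; the factors
`N⁻²` agree on both sides. -/
lemma estimate_forward_mul (G : BackwardFilter M T) (s : ℕ) {N : ℕ} (S S' : WeightedSample X N)
    (h : X → ℝ) :
    estimate (G.forwardSmoothingWeight s S S') (fun i => (S i).1) h *
        avg S (fun x => avg S' fun y => ((M.q x y / G.γ (s + 1) y : ℝ≥0) : ℝ)) =
      avg S fun x => avg S' fun y => ((M.q x y / G.γ (s + 1) y : ℝ≥0) : ℝ) * (h x * 1) := by
  have key := sum_normalized_mul_sum (G.forwardSmoothingWeight s S S') fun i => h (S i).1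
  have hw : ∀ i, (G.forwardSmoothingWeight s S S' i : ℝ) = (S i).2 *
      ∑ j, ((S' j).2 : ℝ) * ((M.q (S i).1 (S' j).1 / G.γ (s + 1) (S' j).1 : ℝ≥0) : ℝ) := by
    intro i
    simp [BackwardFilter.forwardSmoothingWeight, mul_div_assoc]
  have h1 : avg S (fun x => avg S' fun y => ((M.q x y / G.γ (s + 1) y : ℝ≥0) : ℝ)) =
      (N : ℝ)⁻¹ * (N : ℝ)⁻¹ * ∑ i, (G.forwardSmoothingWeight s S S' i : ℝ) := by
    simp only [avg, hw, Finset.mul_sum]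
    refine Finset.sum_congr rfl fun i _ => Finset.sum_congr rfl fun j _ => by ring
  have h2 : avg S (fun x => avg S' fun y =>
      ((M.q x y / G.γ (s + 1) y : ℝ≥0) : ℝ) * (h x * 1)) = (N : ℝ)⁻¹ * (N : ℝ)⁻¹ *
        ∑ i, (G.forwardSmoothingWeight s S S' i : ℝ) * h (S i).1 := by
    simp only [avg, hw, Finset.mul_sum, Finset.sum_mul]
    refine Finset.sum_congr rfl fun i _ => Finset.sum_congr rfl fun j _ => by ring
  rw [h1, h2, ← key, estimate]
  ring

lemma estimate_backward_mul (G : BackwardFilter M T) (s : ℕ) {N : ℕ} (S S' : WeightedSample X N)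
    (h : X → ℝ) :
    estimate (G.backwardSmoothingWeight s S S') (fun i => (S' i).1) h *
        avg S (fun x => avg S' fun y => ((M.q x y / G.γ s y : ℝ≥0) : ℝ)) =
      avg S fun x => avg S' fun y => ((M.q x y / G.γ s y : ℝ≥0) : ℝ) * (1 * h y) := by
  have key := sum_normalized_mul_sum (G.backwardSmoothingWeight s S S') fun i => h (S' i).1
  have hw : ∀ j, (G.backwardSmoothingWeight s S S' j : ℝ) = (S' j).2 *
      ∑ i, ((S i).2 : ℝ) * ((M.q (S i).1 (S' j).1 / G.γ s (S' j).1 : ℝ≥0) : ℝ) := by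
    intro j
    simp [BackwardFilter.backwardSmoothingWeight, mul_div_assoc]
  have h1 : avg S (fun x => avg S' fun y => ((M.q x y / G.γ s y : ℝ≥0) : ℝ)) =
      (N : ℝ)⁻¹ * (N : ℝ)⁻¹ * ∑ j, (G.backwardSmoothingWeight s S S' j : ℝ) := by
    simp only [avg, hw, Finset.mul_sum]
    rw [Finset.sum_comm]
    refine Finset.sum_congr rfl fun i _ => Finset.sum_congr rfl fun j _ => by ring
  have h2 : avg S (fun x => avg S' fun y =>
      ((M.q x y / G.γ s y : ℝ≥0) : ℝ) * (1 * h y)) = (N : ℝ)⁻¹ * (N : ℝ)⁻¹ *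
        ∑ j, (G.backwardSmoothingWeight s S S' j : ℝ) * h (S' j).1 := by
    simp only [avg, hw, Finset.mul_sum, Finset.sum_mul]
    rw [Finset.sum_comm]
    refine Finset.sum_congr rfl fun i _ => Finset.sum_congr rfl fun j _ => by ring
  rw [h1, h2, ← key, estimate]
  ring

variable [SFinite lam]

lemma StateSpaceModel.smoothing_zero (hA1 : AssumptionA1 M T) {s : ℕ} (hs : s < T) :
    M.smoothing T s (fun _ => 0) = 0 := by
  rw [smoothing_eq_forward hA1 hs (h := fun _ => 0) measurable_const (K := 0) (by simp)]
  simp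

lemma hoeffding_forward (F : ForwardFilter M) (G : BackwardFilter M T) (hA1 : AssumptionA1 M T)
    (hA2 : AssumptionA2 F T) (hA3 : AssumptionA3 G) {s : ℕ} (hs : s < T)
    {K : ℝ≥0} (hK : ∀ x x', M.q x x' / G.γ (s + 1) x' ≤ K) :
    ∃ B C : ℝ, 0 < B ∧ 0 < C ∧ ∀ N, 1 ≤ N → ∀ ε : ℝ, 0 < ε → ∀ h : X → ℝ, Measurable h →
      ∀ R : ℝ, 0 < R → (∀ x, |h x| ≤ R) →
      ((F.law N s).prod (G.law N (s + 1)))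
        {S | ε ≤ |estimate (G.forwardSmoothingWeight s S.1 S.2) (fun i => (S.1 i).1) h -
          M.smoothing T s h|} ≤ tail B C N (ε / R) := by
  obtain ⟨B, C, hB, hC, hdev⟩ := deviation_twoFilter F G hA1 hA2 hA3 hs hK
  refine ⟨B, C, hB, hC, fun N hN ε hε h hh R hR hb => ?_⟩
  rw [StateSpaceModel.smoothing_eq_forward hA1 hs hh hb]
  exact hdev N hN ε hε h (fun _ => 1) hh measurable_const R hR (fun x _ => by simpa using hb x) _
    (fun S => abs_estimate_le hN _ _ hb) fun S => estimate_forward_mul G s S.1 S.2 h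

lemma hoeffding_backward (F : ForwardFilter M) (G : BackwardFilter M T) (hA1 : AssumptionA1 M T)
    (hA2 : AssumptionA2 F T) (hA3 : AssumptionA3 G) {s : ℕ} (hs : s < T)
    {K : ℝ≥0} (hK : ∀ x x', M.q x x' / G.γ (s + 1) x' ≤ K) :
    ∃ B C : ℝ, 0 < B ∧ 0 < C ∧ ∀ N, 1 ≤ N → ∀ ε : ℝ, 0 < ε → ∀ h : X → ℝ, Measurable h →
      ∀ R : ℝ, 0 < R → (∀ x, |h x| ≤ R) →
      ((F.law N s).prod (G.law N (s + 1)))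
        {S | ε ≤ |estimate (G.backwardSmoothingWeight (s + 1) S.1 S.2) (fun i => (S.2 i).1) h -
          M.smoothing T (s + 1) h|} ≤ tail B C N (ε / R) := by
  obtain ⟨B, C, hB, hC, hdev⟩ := deviation_twoFilter F G hA1 hA2 hA3 hs hK
  refine ⟨B, C, hB, hC, fun N hN ε hε h hh R hR hb => ?_⟩
  have h1 := hdev N hN ε hε (fun _ => 1) h measurable_const hh R hR
    (fun _ y => by simpa using hb y) _ (fun S => abs_estimate_le hN _ _ hb)
    fun S => estimate_backward_mul G (s + 1) S.1 S.2 h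
  simp only [one_mul] at h1
  rwa [StateSpaceModel.smoothing_eq_backward hA1 hs hh hb]

end Estimators

end TwoFilter

/-! ### The two deviation inequalities with common constants -/

theorem theorem3 {X : Type*} [MeasurableSpace X] (lam : MeasureTheory.Measure X)
    [MeasureTheory.SigmaFinite lam] (M : TwoFilter.StateSpaceModel lam) (T : ℕ)
    (F : TwoFilter.ForwardFilter M) (G : TwoFilter.BackwardFilter M T)
    (hA1 : TwoFilter.AssumptionA1 M T) (hA2 : TwoFilter.AssumptionA2 F T)
    (hA3 : TwoFilter.AssumptionA3 G) (s : ℕ) (hs : 1 ≤ s) (hsT : s + 1 ≤ T) :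
    ∃ B C : ℝ, 0 < B ∧ 0 < C ∧
      ∀ N : ℕ, 1 ≤ N → ∀ ε : ℝ, 0 < ε → ∀ h : X → ℝ, Measurable h → (∃ K, ∀ x, |h x| ≤ K) →
        ((F.law N s).prod (G.law N (s + 1)))
            {S | ε < |TwoFilter.estimate (G.forwardSmoothingWeight s S.1 S.2)
              (fun i => (S.1 i).1) h - M.smoothing T s h|}
          ≤ ENNReal.ofReal (TwoFilter.hoeffdingBound B C N ε h) ∧
        ((s = 1 → ∃ K : ℝ≥0, ∀ x x', M.q x x' / G.γ 1 x' ≤ K) →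
          ((F.law N (s - 1)).prod (G.law N s))
              {S | ε < |TwoFilter.estimate (G.backwardSmoothingWeight s S.1 S.2)
                (fun i => (S.2 i).1) h - M.smoothing T s h|}
            ≤ ENNReal.ofReal (TwoFilter.hoeffdingBound B C N ε h)) := by
  have := M.isProb_χ
  have := nonempty_of_isProbabilityMeasure M.χ
  have hconst : ∀ h : X → ℝ, Measurable h → (∃ K, ∀ x, |h x| ≤ K) → ∀ c,
      M.smoothing T s (fun x => h x - c) = M.smoothing T s h - c := fun h hh hb c =>
    hb.elim fun K hK => TwoFilter.StateSpaceModel.smoothing_sub_const hA1 hsT hh hK c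
  have hzero := TwoFilter.StateSpaceModel.smoothing_zero hA1 hsT
  obtain ⟨K, hK⟩ := hA3.q_bdd s hs hsT
  obtain ⟨B, C, hB, hC, hdev⟩ := TwoFilter.hoeffding_forward F G hA1 hA2 hA3 hsT hK
  -- `B` and `C` are chosen before the extra condition is available. If it fails, the second claim
  -- is vacuous and the forward constants suffice.
  by_cases hcase : s = 1 → ∃ K : ℝ≥0, ∀ x x', M.q x x' / G.γ 1 x' ≤ K
  -- The backward estimator at time `s` pairs times `s - 1` and `s`. A3 at index `s - 1` bounds `q /
  -- γ_s` only for `s ≥ 2`; the extra condition covers `s = 1`.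
  · obtain ⟨t, rfl⟩ : ∃ t, s = t + 1 := ⟨s - 1, by omega⟩
    obtain ⟨K', hK'⟩ : ∃ K : ℝ≥0, ∀ x x', M.q x x' / G.γ (t + 1) x' ≤ K := by
      rcases Nat.eq_zero_or_pos t with rfl | ht
      · exact hcase rfl
      · exact hA3.q_bdd t ht (by omega)
    obtain ⟨B', C', hB', hC', hdev'⟩ :=
      TwoFilter.hoeffding_backward F G hA1 hA2 hA3 (by omega : t < T) hK'
    refine ⟨max B B', min C C', by positivity, by positivity, fun N hN ε hε h hh hb =>
      ⟨?_, fun _ => ?_⟩⟩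
    · exact TwoFilter.measure_le_hoeffdingBound hN hconst hB (le_max_left _ _) (min_le_left _ _)
        hzero (hdev N hN) hε hh hb
    · exact TwoFilter.measure_le_hoeffdingBound hN hconst hB' (le_max_right _ _) (min_le_right _ _)
        hzero (hdev' N hN) hε hh hb
  · refine ⟨B, C, hB, hC, fun N hN ε hε h hh hb => ⟨?_, fun hcon => absurd hcon hcase⟩⟩
    exact TwoFilter.measure_le_hoeffdingBound hN hconst hB le_rfl le_rfl hzero (hdev N hN) hε hh hb
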